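/- For a simple graph $G$ on $n$ vertices with adjacency matrix $A_G$ let $$f_\Delta(G)=\frac1{\binom n3}\sum_{i<j<k}(A_G)_{ij}(A_G)_{jk}(A_G)_{ik},\qquad \widehat p(G)=\binom n2^{-1}\sum_{i<j}(A_G)_{ij}.$$ A random geometric graph distribution $Q$ on graphs with $n$ vertices, with dimension $r_Q=r\in\{1,2,\dots\}$ and edge probability $p_Q=p\in[0,1]$, is the law of the graph obtained from i.i.d. points $x_1,\dots,x_n$, uniform on the unit sphere of $\mathbb R^r$, by joining $i\ne j$ if and only if $x_i^Tx_j\ge\tau$, where $\tau$ is a threshold with $\mathsf P(x_i^Tx_j\ge\tau)=p$ for $i \neq j$. Fix a constant $C>0$. Let $\mathcal F_n$ be the set of such $Q$ on $n$ vertices with $$p_Q\ge\frac1n\quad\text{and}\quad C\le r_Q\le\frac{(np_Q)^4\left(\ln\frac1{p_Q}\right)^3}{\ln n},$$ and let $\mathcal F=\bigcup_{n\ge1}\mathcal F_n$, $\mathcal F_{\ge n}=\bigcup_{m\ge n}\mathcal F_m$. For $Q\in\mathcal F_n$ and $G$ on $n$ vertices put $$\mu(Q)=\mathsf E_{G\sim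 Q}[f_\Delta(G)],\qquad \sigma(Q)=\sqrt{\frac{(3np_Q+1)\,\mu(Q)\ln n}{\binom n3}},\qquad \widehat\sigma(G)=\sqrt{\frac{(3n\widehat p(G)+1)\,f_\Delta(G)\ln n}{\binom n3}}.$$ Then the following hold (suprema over the empty set being $0$). 1. $f_\Delta$ concentrates: $\displaystyle\sup_{Q\in\mathcal F_n}\mathsf P_{G\sim Q}\big(|f_\Delta(G)-\mu(Q)|>\sigma(Q)\big)\to0$ as $n\to\infty$. 2. $\widehat\sigma$ estimates $\sigma$: for every $\delta>0$, $\displaystyle\sup_{Q\in\mathcal F_n}\mathsf P_{G\sim Q}\big(|\widehat\sigma(G)-\sigma(Q)|>\delta\,\sigma(Q)\big)\to0$ as $n\to\infty$. 3. Given independent graphs $G\sim Q$, $G'\sim Q'$, possibly of different sizes, consider the test that accepts $H_0:\mu(Q)=\mu(Q')$ if $T(G,G')\le1$ and rejects it if $T(G,G')>1$, where $$T(G,G')=\frac{|f_\Delta(G)-f_\Delta(G')|}{2\widehat\sigma(G)+2\widehat\sigma(G')}$$ (with $T=0$ if the denominator is $0$). For every function $\rho$ with $\rho(Q,Q')\ge3.5\,(\sigma(Q)+\sigma(Q'))$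 for all $Q,Q'\in\mathcal F$, this test is uniformly consistent against $H_1:|\mu(Q)-\mu(Q')|>\rho(Q,Q')$, that is, as $n\to\infty$, $$\sup_{Q\in\mathcal F_{\ge n}}\Bigg(\sup_{\substack{Q'\in\mathcal F_{\ge n}\\ \mu(Q')=\mu(Q)}}\mathsf P_{G\sim Q,\,G'\sim Q'}\big(T(G,G')>1\big)+\sup_{\substack{Q'\in\mathcal F_{\ge n}\\ |\mu(Q)-\mu(Q')|>\rho(Q,Q')}}\mathsf P_{G\sim Q,\,G'\sim Q'}\big(T(G,G')\le1\big)\Bigg)\to0.$$ -/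

import Mathlib

open MeasureTheory Filter Topology
open scoped ENNReal

noncomputable section

namespace TwoSample

/-! ### Network statistics, concentration, estimability of the deviation, and the test

Graphs on `n` vertices are simple graphs on `Fin n`.  A class `F` of distributions on graphs is
given by its parts `F n`, the members that live on graphs with `n` vertices.  A network statistic
assigns to each graph on `n` vertices, for each `n`, a point of a metric space `S`. -/

/-- Probability distributions on graphs with `n` vertices. -/
abbrev GraphDist (n : ℕ) : Type := ProbabilityMeasure (SimpleGraph (Fin n))

/-- The statistic `f` concentrates on the class `F` about `μ` with deviation `σ`: the supremum over
`Q ∈ F n` of `P_{G ∼ Q} (d(f(G), μ(Q)) > σ(Q))` tends to zero as `n → ∞`. -/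
def Concentrates {S : Type*} [MetricSpace S] (f : (n : ℕ) → SimpleGraph (Fin n) → S)
    (F : (n : ℕ) → Set (GraphDist n)) (μ : (n : ℕ) → GraphDist n → S)
    (σ : (n : ℕ) → GraphDist n → ℝ) : Prop :=
  Tendsto (fun n : ℕ => ⨆ Q ∈ F n, (Q : Measure (SimpleGraph (Fin n)))
    {G | σ n Q < dist (f n G) (μ n Q)}) atTop (𝓝 (0 : ℝ≥0∞))

/-- The function `σhat` of the graph estimates the deviation `σ` on the class `F`: for every
`δ > 0`, the supremum over `Q ∈ F n` of `P_{G ∼ Q} (|σhat(G) - σ(Q)| > δ σ(Q))` tends to zero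
as `n → ∞`. -/
def EstimatesDeviation (F : (n : ℕ) → Set (GraphDist n)) (σ : (n : ℕ) → GraphDist n → ℝ)
    (σhat : (n : ℕ) → SimpleGraph (Fin n) → ℝ) : Prop :=
  ∀ δ : ℝ, 0 < δ →
    Tendsto (fun n : ℕ => ⨆ Q ∈ F n, (Q : Measure (SimpleGraph (Fin n)))
      {G | δ * σ n Q < |σhat n G - σ n Q|}) atTop (𝓝 (0 : ℝ≥0∞))

/-- The two-sample test statistic `d(f(G), f(G')) / (2 σhat(G) + 2 σhat(G'))`.  The null hypothesis
is accepted if it is at most `1` and rejected if it exceeds `1`.  A quotient with denominator zero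
has the value `0` here. -/
def testStat {S : Type*} [MetricSpace S] (f : (n : ℕ) → SimpleGraph (Fin n) → S)
    (σhat : (n : ℕ) → SimpleGraph (Fin n) → ℝ) {m m' : ℕ}
    (G : SimpleGraph (Fin m)) (G' : SimpleGraph (Fin m')) : ℝ :=
  dist (f m G) (f m' G') / (2 * σhat m G + 2 * σhat m' G')

/-- The part on `m'` vertices of `{Q' ∈ F : d(μ(Q), μ(Q')) ≤ ε(Q, Q')}` (null hypothesis). -/
def nullSet {S : Type*} [MetricSpace S] (F : (n : ℕ) → Set (GraphDist n))
    (μ : (n : ℕ) → GraphDist n → S)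
    (ε : (n : ℕ) → GraphDist n → (n' : ℕ) → GraphDist n' → ℝ)
    (m : ℕ) (Q : GraphDist m) (m' : ℕ) : Set (GraphDist m') :=
  {Q' | Q' ∈ F m' ∧ dist (μ m Q) (μ m' Q') ≤ ε m Q m' Q'}

/-- The part on `m'` vertices of `{Q' ∈ F : d(μ(Q), μ(Q')) > ρ(Q, Q')}` (alternative). -/
def altSet {S : Type*} [MetricSpace S] (F : (n : ℕ) → Set (GraphDist n))
    (μ : (n : ℕ) → GraphDist n → S)
    (ρ : (n : ℕ) → GraphDist n → (n' : ℕ) → GraphDist n' → ℝ)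
    (m : ℕ) (Q : GraphDist m) (m' : ℕ) : Set (GraphDist m') :=
  {Q' | Q' ∈ F m' ∧ ρ m Q m' Q' < dist (μ m Q) (μ m' Q')}

/-- The type-I error: the probability of rejection for independent `G ∼ Q` and `G' ∼ Q'`. -/
def rejectProb {S : Type*} [MetricSpace S] (f : (n : ℕ) → SimpleGraph (Fin n) → S)
    (σhat : (n : ℕ) → SimpleGraph (Fin n) → ℝ) {m m' : ℕ}
    (Q : GraphDist m) (Q' : GraphDist m') : ℝ≥0∞ :=
  ((Q : Measure (SimpleGraph (Fin m))).prod (Q' : Measure (SimpleGraph (Fin m'))))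
    {P | 1 < testStat f σhat P.1 P.2}

/-- The type-II error: the probability of acceptance for independent `G ∼ Q` and `G' ∼ Q'`. -/
def acceptProb {S : Type*} [MetricSpace S] (f : (n : ℕ) → SimpleGraph (Fin n) → S)
    (σhat : (n : ℕ) → SimpleGraph (Fin n) → ℝ) {m m' : ℕ}
    (Q : GraphDist m) (Q' : GraphDist m') : ℝ≥0∞ :=
  ((Q : Measure (SimpleGraph (Fin m))).prod (Q' : Measure (SimpleGraph (Fin m'))))
    {P | testStat f σhat P.1 P.2 ≤ 1}

/-- Uniform consistency of the test for `d(μ(Q), μ(Q')) ≤ ε(Q, Q')` against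
`d(μ(Q), μ(Q')) > ρ(Q, Q')`: the supremum, over all `Q ∈ F` on at least `n` vertices, of the worst
type-I error plus the worst type-II error, both over `Q'` on at least `n` vertices, tends to zero
as `n → ∞`. -/
def UniformlyConsistent {S : Type*} [MetricSpace S] (f : (n : ℕ) → SimpleGraph (Fin n) → S)
    (F : (n : ℕ) → Set (GraphDist n)) (μ : (n : ℕ) → GraphDist n → S)
    (σhat : (n : ℕ) → SimpleGraph (Fin n) → ℝ)
    (ε ρ : (n : ℕ) → GraphDist n → (n' : ℕ) → GraphDist n' → ℝ) : Prop :=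
  Tendsto (fun n : ℕ => ⨆ (m : ℕ) (_ : n ≤ m) (Q ∈ F m),
      ((⨆ (m' : ℕ) (_ : n ≤ m') (Q' ∈ nullSet F μ ε m Q m'), rejectProb f σhat Q Q') +
        (⨆ (m' : ℕ) (_ : n ≤ m') (Q' ∈ altSet F μ ρ m Q m'), acceptProb f σhat Q Q')))
    atTop (𝓝 (0 : ℝ≥0∞))

/-! ### Triangle density and edge density -/

open Classical in
/-- The adjacency matrix `A_G`, with real entries. -/
def adjM {n : ℕ} (G : SimpleGraph (Fin n)) : Matrix (Fin n) (Fin n) ℝ :=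
  G.adjMatrix ℝ

/-- The triangle density: the sum of `A i j * A j k * A i k` over `i < j < k`, over `n choose 3`. -/
def fTri (n : ℕ) (G : SimpleGraph (Fin n)) : ℝ :=
  1 / (n.choose 3 : ℝ) * ∑ i : Fin n, ∑ j ∈ Finset.Ioi i, ∑ k ∈ Finset.Ioi j,
    adjM G i j * adjM G j k * adjM G i k

/-- The edge density: the sum of `A i j` over `i < j`, over `n choose 2`. -/
def edgeDensity (n : ℕ) (G : SimpleGraph (Fin n)) : ℝ :=
  (n.choose 2 : ℝ)⁻¹ * ∑ i : Fin n, ∑ j ∈ Finset.Ioi i, adjM G i j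

/-! ### Random geometric graphs -/

/-- The uniform probability distribution on the unit sphere of `ℝ^r` (for `r ≥ 1`): normalised
surface measure. -/
def sphereUniform (r : ℕ) : Measure (Metric.sphere (0 : EuclideanSpace ℝ (Fin r)) 1) :=
  ((volume : Measure (EuclideanSpace ℝ (Fin r))).toSphere Set.univ)⁻¹ •
    (volume : Measure (EuclideanSpace ℝ (Fin r))).toSphere

/-- The geometric graph of the points `x 0, …, x (n - 1)`: distinct `i`, `j` are adjacent when the
inner product of `x i` and `x j` is at least `τ`. -/
def geomGraph {n r : ℕ} (τ : ℝ) (x : Fin n → Metric.sphere (0 : EuclideanSpace ℝ (Fin r)) 1) :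
    SimpleGraph (Fin n) where
  Adj i j := i ≠ j ∧ τ ≤ inner ℝ (x i).1 (x j).1
  symm := ⟨fun _ _ h => ⟨h.1.symm, by simpa only [real_inner_comm] using h.2⟩⟩
  loopless := ⟨fun _ h => h.1 rfl⟩

/-- `Q` is the random geometric graph distribution on `n` vertices with dimension `r` and edge
probability `p`: the points are independent and uniform on the unit sphere of `ℝ^r`, and the
threshold `τ` is such that two of them have inner product at least `τ` with probability `p`. -/
def IsGeom (n r : ℕ) (p : ℝ) (Q : GraphDist n) : Prop :=
  1 ≤ r ∧ ∃ τ : ℝ,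
    ((sphereUniform r).prod (sphereUniform r)).real
      {z | τ ≤ inner ℝ z.1.1 z.2.1} = p ∧
    (Q : Measure (SimpleGraph (Fin n))) =
      Measure.map (geomGraph τ) (Measure.pi fun _ : Fin n => sphereUniform r)

/-- The edge probability `p_Q` of a distribution: the expected edge density.  For a random
geometric graph on at least two vertices it is the parameter `p`, see `IsGeom.edgeProb_eq`. -/
def edgeProb (n : ℕ) (Q : GraphDist n) : ℝ :=
  ∫ G, edgeDensity n G ∂(Q : Measure (SimpleGraph (Fin n)))

/-- The expected triangle density `μ(Q)`. -/
def muTri (n : ℕ) (Q : GraphDist n) : ℝ :=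
  ∫ G, fTri n G ∂(Q : Measure (SimpleGraph (Fin n)))

/-- The class of random geometric graphs with `p ≥ 1 / n` and
`C ≤ r ≤ (n p)^4 (ln (1 / p))^3 / ln n`. -/
def geomClass (C : ℝ) (n : ℕ) : Set (GraphDist n) :=
  {Q | 1 ≤ n ∧ ∃ (r : ℕ) (p : ℝ), IsGeom n r p Q ∧ 1 / (n : ℝ) ≤ p ∧ C ≤ (r : ℝ) ∧
    (r : ℝ) ≤ ((n : ℝ) * p) ^ 4 * Real.log (1 / p) ^ 3 / Real.log n}

/-- The deviation `σ(Q) = √((3 n p_Q + 1) μ(Q) ln n / (n choose 3))`. -/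
def sigmaTri (n : ℕ) (Q : GraphDist n) : ℝ :=
  Real.sqrt ((3 * n * edgeProb n Q + 1) * muTri n Q * Real.log n / (n.choose 3 : ℝ))

/-- The estimator of the deviation, with the edge density in place of the edge probability and the
triangle density in place of its expectation. -/
def sigmaHatTri (n : ℕ) (G : SimpleGraph (Fin n)) : ℝ :=
  Real.sqrt ((3 * n * edgeDensity n G + 1) * fTri n G * Real.log n / (n.choose 3 : ℝ))

/-! ### The edge probability of a random geometric graph is its parameter -/

theorem isProbabilityMeasure_sphereUniform {r : ℕ} (hr : 1 ≤ r) :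
    IsProbabilityMeasure (sphereUniform r) := by
  have : Nonempty (Fin r) := ⟨⟨0, hr⟩⟩
  have : Nontrivial (EuclideanSpace ℝ (Fin r)) :=
    inferInstance
  refine ⟨?_⟩
  rw [sphereUniform, Measure.smul_apply, smul_eq_mul]
  refine ENNReal.inv_mul_cancel ?_ (measure_ne_top _ _)
  rw [Ne, Measure.measure_univ_eq_zero]
  exact Measure.toSphere_ne_zero _

theorem measurable_geomGraph {n r : ℕ} (τ : ℝ) : Measurable
    (geomGraph τ : (Fin n → Metric.sphere (0 : EuclideanSpace ℝ (Fin r)) 1) →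
      SimpleGraph (Fin n)) := by
  rw [SimpleGraph.measurable_iff_adj]
  intro u v
  simp only [geomGraph]
  refine Measurable.and measurable_const ?_
  refine measurableSet_setOfPred.1 ?_
  exact measurableSet_le measurable_const (by fun_prop)

theorem IsGeom.adj_prob {n r : ℕ} {p : ℝ} {Q : GraphDist n} (h : IsGeom n r p Q) {i j : Fin n}
    (hij : i ≠ j) : (Q : Measure (SimpleGraph (Fin n))).real {G | G.Adj i j} = p := by
  obtain ⟨hr, τ, hp, hQ⟩ := h
  have := isProbabilityMeasure_sphereUniform hr
  have hm : MeasurableSet {G : SimpleGraph (Fin n) | G.Adj i j} :=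
    measurableSet_setOfPred.2 (by fun_prop)
  have hind := (ProbabilityTheory.iIndepFun_pi (μ := fun _ : Fin n => sphereUniform r)
    (X := fun _ => id) (fun _ => aemeasurable_id)).indepFun hij
  have hmap := (ProbabilityTheory.indepFun_iff_map_prod_eq_prod_map_map
    (measurable_pi_apply i).aemeasurable (measurable_pi_apply j).aemeasurable).1 hind
  have e (k : Fin n) : Measure.map (fun x : Fin n → Metric.sphere (0 : EuclideanSpace ℝ (Fin r)) 1 => x k)
      (Measure.pi fun _ : Fin n => sphereUniform r) = sphereUniform r :=
    (measurePreserving_eval (fun _ : Fin n => sphereUniform r) k).map_eq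
  rw [e i, e j] at hmap
  have hm2 : MeasurableSet {z : Metric.sphere (0 : EuclideanSpace ℝ (Fin r)) 1 ×
      Metric.sphere (0 : EuclideanSpace ℝ (Fin r)) 1 | τ ≤ inner ℝ z.1.1 z.2.1} :=
    measurableSet_le measurable_const (by fun_prop)
  rw [← hp, ← hmap, hQ, measureReal_def, measureReal_def,
    Measure.map_apply (measurable_geomGraph τ) hm, Measure.map_apply (by fun_prop) hm2]
  congr 2
  ext x
  simp [geomGraph, hij]

theorem IsGeom.edgeProb_eq {n r : ℕ} {p : ℝ} {Q : GraphDist n} (h : IsGeom n r p Q)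
    (hn : 2 ≤ n) : edgeProb n Q = p := by
  have hm (i j : Fin n) : MeasurableSet {G : SimpleGraph (Fin n) | G.Adj i j} :=
    measurableSet_setOfPred.2 (by fun_prop)
  have hind (i j : Fin n) : (fun G : SimpleGraph (Fin n) =>
      adjM G i j) =
      Set.indicator {G : SimpleGraph (Fin n) | G.Adj i j} 1 := by
    ext G
    by_cases hG : G.Adj i j
    · rw [Set.indicator_of_mem (s := {G : SimpleGraph (Fin n) | G.Adj i j}) hG]
      simp [adjM, hG]
    · rw [Set.indicator_of_notMem (s := {G : SimpleGraph (Fin n) | G.Adj i j}) hG]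
      simp [adjM, hG]
  have hint (i j : Fin n) : Integrable (Set.indicator {G : SimpleGraph (Fin n) | G.Adj i j}
      (1 : SimpleGraph (Fin n) → ℝ)) (Q : Measure (SimpleGraph (Fin n))) :=
    (integrable_const (1 : ℝ)).indicator (hm i j)
  have hcount : ∑ i : Fin n, ∑ j ∈ Finset.Ioi i, p = (n.choose 2 : ℝ) * p := by
    simp only [Finset.sum_const, Fin.card_Ioi, nsmul_eq_mul]
    rw [← Finset.sum_mul, ← Nat.cast_sum, Nat.choose_two_right, ← Finset.sum_range_id,
      ← Finset.sum_range_reflect, Finset.sum_range]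
  have hch : (n.choose 2 : ℝ) ≠ 0 := by
    exact_mod_cast (Nat.choose_pos hn).ne'
  have key : ∫ G, (∑ i : Fin n, ∑ j ∈ Finset.Ioi i,
      adjM G i j)
      ∂(Q : Measure (SimpleGraph (Fin n))) = ∑ i : Fin n, ∑ j ∈ Finset.Ioi i, p := by
    rw [integral_finsetSum]
    · refine Finset.sum_congr rfl fun i _ => ?_
      rw [integral_finsetSum]
      · refine Finset.sum_congr rfl fun j hj => ?_
        rw [hind, integral_indicator_one (hm i j),
          h.adj_prob (Finset.mem_Ioi.1 hj).ne]
      · intro j _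
        rw [hind]
        exact hint i j
    · intro i _
      refine integrable_finsetSum _ fun j _ => ?_
      rw [hind]
      exact hint i j
  unfold edgeProb edgeDensity
  rw [integral_const_mul, key, hcount, inv_mul_cancel_left₀ hch]

end TwoSample

end

/-!
Concentration of the triangle density of random geometric graphs.

The probabilistic half is Chebyshev's inequality.  By rotation invariance, the probability that a
random point is adjacent to a given one, and that two random points form a triangle with a given
one, do not depend on the given point.  Hence edges are pairwise independent, and triangles with at
most one common vertex are independent; two triangles with a common edge occur together with
probability at most `p μ`, as one may forget one of the five edges (`EdgeTriangleLaw`).  So the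
edge density has variance at most `p / (n choose 2)`, and the triangle density has variance at most
`(3 n p + 1) μ / (n choose 3) = σ ^ 2 / ln n`, which gives the concentration.

The relative error of the triangle density, hence that of the estimated deviation, tends to zero
provided that `n ^ 2 μ / p → ∞` uniformly on the class (`eventually_mul_edge_le_triangle`).
This rests on a lower bound for `μ`.  A uniform point of the sphere of `ℝ^r` has a latitude and an
independent, uniform meridian in the sphere of `ℝ^(r-1)` (`sphereUniform_succ`).  Two points of the
cap of height `τ` around a third one are adjacent as soon as their meridians have inner product at
least `τ / (1 + τ)`.  So, with `F r τ` the edge probability at threshold `τ`,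
`μ ≥ F r τ ^ 2 * F (r - 1) (τ / (1 + τ)) ≥ F r τ ^ 2 * F r (τ / (1 + τ))`
(`sphereTriangleProb_ge`, `sphereEdgeProb_succ_le`).  This yields `μ ≥ p ^ 3`, which suffices
where `n p` is large.  Where `n p` is bounded, the class has `r = O(ln (1 / p) ^ 2)`.  The tangent
of the latitude has a density proportional to `(1 + q ^ 2) ^ (-r / 2)`, and scaling `q` shows that
`F r (τ / (1 + τ))` exceeds `F r τ` by a factor of order at least `exp (c τ ln (1 / p))`
(`sphereTriangleProb_ge_exp`); a lower bound for `F r τ` shows that `τ ln (1 / p)` is then large.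

The test is consistent by the triangle inequality, outside the exceptional events that a triangle
density deviates by more than `σ` or an estimated deviation is off by more than a quarter.
-/

namespace TwoSample

/-! ### Integrating out vertices of a random graph with independent vertex labels -/

lemma indicator_one_congr {α β : Type*} {A : Set α} {B : Set β} {a : α} {b : β}
    (h : a ∈ A ↔ b ∈ B) : A.indicator (1 : α → ℝ≥0∞) a = B.indicator (1 : β → ℝ≥0∞) b := by
  by_cases hb : b ∈ B
  · simp [hb, h.2 hb]
  · simp [hb, mt h.1 hb]

section LabelClique

variable {S : Type*} {n : ℕ}

/-- The labels in `s` are pairwise related. -/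
def labelClique (R : S → S → Prop) (s : Finset (Fin n)) : Set (Fin n → S) :=
  {x | ∀ a ∈ s, ∀ b ∈ s, a ≠ b → R (x a) (x b)}

lemma update_mem_labelClique {R : S → S → Prop} {s : Finset (Fin n)} {i : Fin n} (hi : i ∉ s)
    (x : Fin n → S) (y : S) : Function.update x i y ∈ labelClique R s ↔ x ∈ labelClique R s := by
  have h (a : Fin n) (ha : a ∈ s) : Function.update x i y a = x a :=
    Function.update_of_ne (fun h : a = i => hi (h ▸ ha)) _ _
  simp only [labelClique, Set.mem_ofPred_eq]
  refine forall₂_congr fun a ha => forall₂_congr fun b hb => ?_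
  rw [h a ha, h b hb]

lemma labelClique_triple {R : S → S → Prop} (hsymm : ∀ x y, R x y → R y x) {i j k : Fin n}
    (hij : i ≠ j) (hik : i ≠ k) (hjk : j ≠ k) :
    labelClique R {i, j, k} = {x | R (x i) (x j) ∧ R (x i) (x k) ∧ R (x j) (x k)} := by
  ext x
  simp only [labelClique, Set.mem_ofPred_eq, Finset.mem_insert, Finset.mem_singleton]
  constructor
  · intro h
    exact ⟨h i (by simp) j (by simp) hij, h i (by simp) k (by simp) hik,
      h j (by simp) k (by simp) hjk⟩
  · rintro ⟨h1, h2, h3⟩ a (rfl | rfl | rfl) b (rfl | rfl | rfl) hab <;>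
      first | exact absurd rfl hab | assumption | (apply hsymm; assumption)

end LabelClique

section VertexLabels

variable {S : Type*} [MeasurableSpace S] (ν : Measure S) [IsProbabilityMeasure ν] {n : ℕ}

/-- Resampling one coordinate does not change an integral over a product measure. -/
lemma lintegral_pi_update {f : (Fin n → S) → ℝ≥0∞} (hf : Measurable f) (i : Fin n) :
    ∫⁻ x, f x ∂(Measure.pi fun _ : Fin n => ν) =
      ∫⁻ x, ∫⁻ y, f (Function.update x i y) ∂ν ∂(Measure.pi fun _ : Fin n => ν) := by
  have h1 : (fun x => ∫⁻ y, f (Function.update x i y) ∂ν) =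
      lmarginal (fun _ : Fin n => ν) {i} f :=
    (lmarginal_singleton (μ := fun _ : Fin n => ν) f i).symm
  rw [h1]
  refine lintegral_eq_of_lmarginal_eq {i} hf (hf.lmarginal _) ?_
  ext x
  rw [lmarginal_singleton (lmarginal (fun _ : Fin n => ν) {i} f)]
  simp [lmarginal_update_of_mem]

/-- If every `z` is related to `y ∼ ν` with the same probability `p`, then a relation between the
labels of `i` and `j` is independent of any event `B` that does not involve the label of `i`. -/
lemma pi_edge_inter {R : S → S → Prop} (hR : MeasurableSet {z : S × S | R z.1 z.2}) {p : ℝ≥0∞}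
    (hp : ∀ z, ν {y | R y z} = p) {i j : Fin n} (hij : i ≠ j) {B : Set (Fin n → S)}
    (hB : MeasurableSet B) (hBi : ∀ x y, Function.update x i y ∈ B ↔ x ∈ B) :
    (Measure.pi fun _ : Fin n => ν) ({x | R (x i) (x j)} ∩ B) =
      p * (Measure.pi fun _ : Fin n => ν) B := by
  have hA : MeasurableSet ({x : Fin n → S | R (x i) (x j)} ∩ B) :=
    (measurableSet_preimage (f := fun x : Fin n → S => (x i, x j)) (by fun_prop) hR).inter hB
  rw [← lintegral_indicator_one hA, lintegral_pi_update ν (measurable_one.indicator hA) i,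
    ← lintegral_indicator_one hB, ← lintegral_const_mul _ (measurable_one.indicator hB)]
  refine lintegral_congr fun x => ?_
  by_cases hx : x ∈ B
  · have hE : MeasurableSet {y : S | R y (x j)} :=
      measurableSet_preimage (f := fun y : S => (y, x j)) (by fun_prop) hR
    rw [Set.indicator_of_mem hx, Pi.one_apply, mul_one, ← hp (x j),
      ← lintegral_indicator_one hE]
    refine lintegral_congr fun y => ?_
    refine indicator_one_congr ?_
    simp only [Set.mem_inter_iff, hBi, hx, and_true, Set.mem_ofPred_eq,
      Function.update_self, Function.update_of_ne hij.symm]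
  · rw [Set.indicator_of_notMem hx, mul_zero]
    simp [Set.indicator, hBi, hx]

/-- If for every `z` two independent `ν`-distributed labels are related to `z` and to each other
with the same probability `m`, then the event that `i`, `j`, `k` are pairwise related is
independent of any event `B` that does not involve the labels of `j` and `k`. -/
lemma pi_triangle_inter {R : S → S → Prop} (hR : MeasurableSet {z : S × S | R z.1 z.2})
    {m : ℝ≥0∞} (hm : ∀ x, (ν.prod ν) {z | R x z.1 ∧ R x z.2 ∧ R z.1 z.2} = m)
    {i j k : Fin n} (hij : i ≠ j) (hik : i ≠ k) (hjk : j ≠ k) {B : Set (Fin n → S)}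
    (hB : MeasurableSet B) (hBj : ∀ x y, Function.update x j y ∈ B ↔ x ∈ B)
    (hBk : ∀ x y, Function.update x k y ∈ B ↔ x ∈ B) :
    (Measure.pi fun _ : Fin n => ν)
        ({x | R (x i) (x j) ∧ R (x i) (x k) ∧ R (x j) (x k)} ∩ B) =
      m * (Measure.pi fun _ : Fin n => ν) B := by
  have hpre {α : Type _} [MeasurableSpace α] {f g : α → S} (hf : Measurable f)
      (hg : Measurable g) : MeasurableSet {x | R (f x) (g x)} :=
    measurableSet_preimage (f := fun x => (f x, g x)) (hf.prodMk hg) hR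
  have hA : MeasurableSet ({x : Fin n → S | R (x i) (x j) ∧ R (x i) (x k) ∧ R (x j) (x k)} ∩ B) :=
    ((hpre (by fun_prop) (by fun_prop)).inter ((hpre (by fun_prop) (by fun_prop)).inter
      (hpre (by fun_prop) (by fun_prop)))).inter hB
  have hmeas : Measurable fun x : Fin n → S => ∫⁻ y, ({x : Fin n → S | R (x i) (x j) ∧
      R (x i) (x k) ∧ R (x j) (x k)} ∩ B).indicator (1 : (Fin n → S) → ℝ≥0∞)
        (Function.update x k y) ∂ν := by
    have := (measurable_one.indicator hA : Measurable
      (Set.indicator _ (1 : (Fin n → S) → ℝ≥0∞))).lmarginal (fun _ : Fin n => ν) (s := {k})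
    rwa [lmarginal_singleton] at this
  rw [← lintegral_indicator_one hA, lintegral_pi_update ν (measurable_one.indicator hA) k,
    lintegral_pi_update ν hmeas j,
    ← lintegral_indicator_one hB, ← lintegral_const_mul _ (measurable_one.indicator hB)]
  refine lintegral_congr fun x => ?_
  by_cases hx : x ∈ B
  · have hT : MeasurableSet {z : S × S | R (x i) z.1 ∧ R (x i) z.2 ∧ R z.1 z.2} :=
      (hpre (by fun_prop) (by fun_prop)).inter ((hpre (by fun_prop) (by fun_prop)).inter
        (hpre (by fun_prop) (by fun_prop)))
    rw [Set.indicator_of_mem hx, Pi.one_apply, mul_one, ← hm (x i),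
      ← lintegral_indicator_one hT, lintegral_prod _ (measurable_one.indicator hT).aemeasurable]
    refine lintegral_congr fun y => lintegral_congr fun z => ?_
    refine indicator_one_congr ?_
    simp only [Set.mem_inter_iff, hBj, hBk, hx, and_true, Set.mem_ofPred_eq,
      Function.update_self, Function.update_of_ne hij, Function.update_of_ne hik,
      Function.update_of_ne hjk]
  · rw [Set.indicator_of_notMem hx, mul_zero]
    simp [Set.indicator, hBj, hBk, hx]

lemma measurableSet_labelClique {R : S → S → Prop} (hR : MeasurableSet {z : S × S | R z.1 z.2})
    (s : Finset (Fin n)) : MeasurableSet (labelClique R s) := by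
  have : labelClique R s = ⋂ a ∈ s, ⋂ b ∈ s, {x | a ≠ b → R (x a) (x b)} := by
    ext x; simp [labelClique]
  rw [this]
  refine Finset.measurableSet_biInter _ fun a _ => Finset.measurableSet_biInter _ fun b _ => ?_
  by_cases h : a = b
  · simp [h]
  · simpa [h] using measurableSet_preimage (f := fun x : Fin n → S => (x a, x b))
      (by fun_prop) hR

variable {ν}

lemma pi_labelClique_inter {R : S → S → Prop} (hR : MeasurableSet {z : S × S | R z.1 z.2})
    (hsymm : ∀ x y, R x y → R y x)
    {m : ℝ≥0∞} (hm : ∀ x, (ν.prod ν) {z | R x z.1 ∧ R x z.2 ∧ R z.1 z.2} = m)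
    {s : Finset (Fin n)} (hs : s.card = 3) {B : Set (Fin n → S)} (hB : MeasurableSet B)
    {j k : Fin n} (hj : j ∈ s) (hk : k ∈ s) (hjk : j ≠ k)
    (hBj : ∀ x y, Function.update x j y ∈ B ↔ x ∈ B)
    (hBk : ∀ x y, Function.update x k y ∈ B ↔ x ∈ B) :
    (Measure.pi fun _ : Fin n => ν) (labelClique R s ∩ B) =
      m * (Measure.pi fun _ : Fin n => ν) B := by
  obtain ⟨i, hi⟩ : ∃ i, (s.erase j).erase k = {i} := by
    rw [← Finset.card_eq_one, Finset.card_erase_of_mem (Finset.mem_erase.2 ⟨hjk.symm, hk⟩),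
      Finset.card_erase_of_mem hj, hs]
  have hi' : i ∈ (s.erase j).erase k := by simp [hi]
  simp only [Finset.mem_erase] at hi'
  have hsi : s = {i, j, k} := by
    rw [← Finset.insert_erase hj, ← Finset.insert_erase (Finset.mem_erase.2 ⟨hjk.symm, hk⟩), hi]
    ext a; simp; tauto
  rw [hsi, labelClique_triple hsymm hi'.2.1 hi'.1 hjk]
  exact pi_triangle_inter ν hR hm hi'.2.1 hi'.1 hjk hB hBj hBk

lemma pi_labelClique {R : S → S → Prop} (hR : MeasurableSet {z : S × S | R z.1 z.2})
    (hsymm : ∀ x y, R x y → R y x)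
    {m : ℝ≥0∞} (hm : ∀ x, (ν.prod ν) {z | R x z.1 ∧ R x z.2 ∧ R z.1 z.2} = m)
    {s : Finset (Fin n)} (hs : s.card = 3) :
    (Measure.pi fun _ : Fin n => ν) (labelClique R s) = m := by
  obtain ⟨j, hj, k, hk, hjk⟩ := Finset.one_lt_card.1 (by omega : 1 < s.card)
  simpa using pi_labelClique_inter hR hsymm hm hs MeasurableSet.univ hj hk hjk (by simp) (by simp)

/-- Triangles with at most one common vertex are independent. -/
lemma pi_labelClique_inter_of_card_le_one {R : S → S → Prop}
    (hR : MeasurableSet {z : S × S | R z.1 z.2}) (hsymm : ∀ x y, R x y → R y x)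
    {m : ℝ≥0∞} (hm : ∀ x, (ν.prod ν) {z | R x z.1 ∧ R x z.2 ∧ R z.1 z.2} = m)
    {s t : Finset (Fin n)} (hs : s.card = 3) (ht : t.card = 3) (hst : (s ∩ t).card ≤ 1) :
    (Measure.pi fun _ : Fin n => ν) (labelClique R s ∩ labelClique R t) = m * m := by
  have hc : 1 < (s \ t).card := by
    have := Finset.card_sdiff_add_card_inter s t
    omega
  obtain ⟨j, hj, k, hk, hjk⟩ := Finset.one_lt_card.1 hc
  rw [Finset.mem_sdiff] at hj hk
  rw [pi_labelClique_inter hR hsymm hm hs (measurableSet_labelClique hR t) hj.1 hk.1 hjk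
    (update_mem_labelClique hj.2) (update_mem_labelClique hk.2), pi_labelClique hR hsymm hm ht]

/-- For two triangles with a common edge, drop one of the two remaining edges of the second. -/
lemma pi_labelClique_inter_of_card_eq_two {R : S → S → Prop}
    (hR : MeasurableSet {z : S × S | R z.1 z.2}) (hsymm : ∀ x y, R x y → R y x)
    {p m : ℝ≥0∞} (hp : ∀ z, ν {y | R y z} = p)
    (hm : ∀ x, (ν.prod ν) {z | R x z.1 ∧ R x z.2 ∧ R z.1 z.2} = m)
    {s t : Finset (Fin n)} (hs : s.card = 3) (ht : t.card = 3) (hst : (s ∩ t).card = 2) :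
    (Measure.pi fun _ : Fin n => ν) (labelClique R s ∩ labelClique R t) ≤ p * m := by
  have hc : 0 < (t \ s).card := by
    have := Finset.card_sdiff_add_card_inter t s
    rw [Finset.inter_comm] at this
    omega
  obtain ⟨d, hd⟩ := Finset.card_pos.1 hc
  obtain ⟨a, ha⟩ := Finset.card_pos.1 (by omega : 0 < (s ∩ t).card)
  rw [Finset.mem_sdiff] at hd
  rw [Finset.mem_inter] at ha
  have hda : d ≠ a := fun h => hd.2 (h ▸ ha.1)
  rw [← pi_labelClique hR hsymm hm hs, ← pi_edge_inter ν hR hp hda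
    (measurableSet_labelClique hR s) (update_mem_labelClique hd.2)]
  exact measure_mono fun x hx => ⟨hx.2 d hd.1 a ha.2 hda, hx.1⟩

end VertexLabels

/-! ### Rotation invariance of the uniform distribution on the sphere -/

section Rotation

open scoped Pointwise

/-- The action of a linear isometry on the unit sphere. -/
noncomputable def sphereMap {r : ℕ} (U : EuclideanSpace ℝ (Fin r) ≃ₗᵢ[ℝ] EuclideanSpace ℝ (Fin r))
    (x : Metric.sphere (0 : EuclideanSpace ℝ (Fin r)) 1) :
    Metric.sphere (0 : EuclideanSpace ℝ (Fin r)) 1 :=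
  ⟨U x.1, by simp⟩

lemma measurable_sphereMap {r : ℕ}
    (U : EuclideanSpace ℝ (Fin r) ≃ₗᵢ[ℝ] EuclideanSpace ℝ (Fin r)) : Measurable (sphereMap U) :=
  (U.continuous.measurable.comp measurable_subtype_coe).subtype_mk

lemma measurePreserving_sphereMap {r : ℕ}
    (U : EuclideanSpace ℝ (Fin r) ≃ₗᵢ[ℝ] EuclideanSpace ℝ (Fin r)) :
    MeasurePreserving (sphereMap U) (sphereUniform r) (sphereUniform r) := by
  refine ⟨measurable_sphereMap U, ?_⟩
  ext s hs
  rw [Measure.map_apply (measurable_sphereMap U) hs, sphereUniform, Measure.smul_apply,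
    Measure.smul_apply, Measure.toSphere_apply' _ hs,
    Measure.toSphere_apply' _ (measurable_sphereMap U hs)]
  congr 2
  refine Eq.trans ?_ (U.measurePreserving.measure_preimage_equiv (f := U.toMeasurableEquiv) _)
  congr 1
  ext x
  simp only [Set.mem_preimage, Set.mem_smul, Set.mem_image, Subtype.exists]
  constructor
  · rintro ⟨t, ht, _, ⟨y, hy, hys, rfl⟩, rfl⟩
    refine ⟨t, ht, _, ⟨U y, by simpa using hy, hys, rfl⟩, by simp⟩
  · rintro ⟨t, ht, _, ⟨y, hy, hys, rfl⟩, hyx⟩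
    refine ⟨t, ht, _, ⟨U.symm y, by simpa using hy, by simpa [sphereMap] using hys, rfl⟩, ?_⟩
    apply U.injective
    simpa using hyx

lemma exists_sphereMap_eq {r : ℕ} (x y : Metric.sphere (0 : EuclideanSpace ℝ (Fin r)) 1) :
    ∃ U : EuclideanSpace ℝ (Fin r) ≃ₗᵢ[ℝ] EuclideanSpace ℝ (Fin r), sphereMap U x = y := by
  refine ⟨(Submodule.span ℝ {x.1 - y.1})ᗮ.reflection, Subtype.ext ?_⟩
  exact Submodule.reflection_sub (by simp)

lemma inner_sphereMap {r : ℕ} (U : EuclideanSpace ℝ (Fin r) ≃ₗᵢ[ℝ] EuclideanSpace ℝ (Fin r))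
    (x y : Metric.sphere (0 : EuclideanSpace ℝ (Fin r)) 1) :
    inner ℝ (sphereMap U x).1 (sphereMap U y).1 = inner ℝ x.1 y.1 :=
  U.inner_map_map _ _

lemma measurableSet_inner {r : ℕ} {α : Type*} [MeasurableSpace α] (τ : ℝ)
    {f g : α → Metric.sphere (0 : EuclideanSpace ℝ (Fin r)) 1} (hf : Measurable f)
    (hg : Measurable g) : MeasurableSet {a | τ ≤ inner ℝ (f a).1 (g a).1} :=
  measurableSet_le measurable_const
    ((measurable_subtype_coe.comp hf).inner (measurable_subtype_coe.comp hg))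

/-- All spherical caps of the same height have the same measure. -/
lemma sphereUniform_cap_eq {r : ℕ} (τ : ℝ) (x y : Metric.sphere (0 : EuclideanSpace ℝ (Fin r)) 1) :
    sphereUniform r {z | τ ≤ inner ℝ z.1 x.1} = sphereUniform r {z | τ ≤ inner ℝ z.1 y.1} := by
  obtain ⟨U, rfl⟩ := exists_sphereMap_eq x y
  rw [← (measurePreserving_sphereMap U).measure_preimage
    (measurableSet_inner τ measurable_id measurable_const).nullMeasurableSet
    (s := {z | τ ≤ inner ℝ z.1 (sphereMap U x).1})]
  simp only [Set.preimage_ofPred_eq, inner_sphereMap]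

/-- The probability that two random points form a triangle with a given one does not depend
on the latter. -/
lemma sphereUniform_triangle_eq {r : ℕ} [SFinite (sphereUniform r)] (τ : ℝ)
    (x y : Metric.sphere (0 : EuclideanSpace ℝ (Fin r)) 1) :
    ((sphereUniform r).prod (sphereUniform r)) {z | τ ≤ inner ℝ x.1 z.1.1 ∧
      τ ≤ inner ℝ x.1 z.2.1 ∧ τ ≤ inner ℝ z.1.1 z.2.1} =
    ((sphereUniform r).prod (sphereUniform r)) {z | τ ≤ inner ℝ y.1 z.1.1 ∧
      τ ≤ inner ℝ y.1 z.2.1 ∧ τ ≤ inner ℝ z.1.1 z.2.1} := by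
  obtain ⟨U, rfl⟩ := exists_sphereMap_eq x y
  have hU := (measurePreserving_sphereMap U).prod (measurePreserving_sphereMap U)
  have hm : MeasurableSet {z : Metric.sphere (0 : EuclideanSpace ℝ (Fin r)) 1 ×
      Metric.sphere (0 : EuclideanSpace ℝ (Fin r)) 1 | τ ≤ inner ℝ (sphereMap U x).1 z.1.1 ∧
      τ ≤ inner ℝ (sphereMap U x).1 z.2.1 ∧ τ ≤ inner ℝ z.1.1 z.2.1} :=
    (measurableSet_inner τ measurable_const measurable_fst).inter
      ((measurableSet_inner τ measurable_const measurable_snd).inter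
        (measurableSet_inner τ measurable_fst measurable_snd))
  rw [← hU.measure_preimage hm.nullMeasurableSet]
  simp only [Set.preimage_ofPred_eq, Prod.map_fst, Prod.map_snd, inner_sphereMap]

end Rotation

/-! ### Edges and triangles of a random geometric graph -/

/-- The vertices in `s` are pairwise adjacent. -/
def cliqueEvent {n : ℕ} (s : Finset (Fin n)) : Set (SimpleGraph (Fin n)) :=
  {G | ∀ a ∈ s, ∀ b ∈ s, a ≠ b → G.Adj a b}

lemma measurableSet_adj {n : ℕ} (i j : Fin n) :
    MeasurableSet {G : SimpleGraph (Fin n) | G.Adj i j} :=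
  measurableSet_setOfPred.2 (by fun_prop)

lemma measurableSet_cliqueEvent {n : ℕ} (s : Finset (Fin n)) : MeasurableSet (cliqueEvent s) := by
  have : cliqueEvent s = ⋂ a ∈ s, ⋂ b ∈ s, {G | a ≠ b → G.Adj a b} := by
    ext x; simp [cliqueEvent]
  rw [this]
  refine Finset.measurableSet_biInter _ fun a _ => Finset.measurableSet_biInter _ fun b _ => ?_
  by_cases h : a = b
  · simp [h]
  · simpa [h] using measurableSet_adj a b

lemma geomGraph_preimage_cliqueEvent {n r : ℕ} (τ : ℝ) (s : Finset (Fin n)) :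
    (geomGraph τ : (Fin n → Metric.sphere (0 : EuclideanSpace ℝ (Fin r)) 1) → _) ⁻¹'
      cliqueEvent s = labelClique (fun x y => τ ≤ inner ℝ x.1 y.1) s := by
  ext x
  simp only [cliqueEvent, labelClique, geomGraph, Set.mem_preimage, Set.mem_ofPred_eq]
  exact forall₅_congr fun a _ b _ h => by simp [h]

/-- The law of the edges and triangles of a random graph with edge probability `p` and triangle
probability `m`, as far as it determines the variances of the edge and triangle counts up to
constants. -/
structure EdgeTriangleLaw {n : ℕ} (Q : GraphDist n) (p m : ℝ) : Prop where
  adj_inter {i j k l : Fin n} (hij : i ≠ j) (hkl : k ≠ l) (hne : i ≠ k ∨ j ≠ l)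
    (hne' : i ≠ l ∨ j ≠ k) : (Q : Measure (SimpleGraph (Fin n))).real
      ({G | G.Adj i j} ∩ {G | G.Adj k l}) = p * p
  adj {i j : Fin n} (hij : i ≠ j) : (Q : Measure (SimpleGraph (Fin n))).real {G | G.Adj i j} = p
  clique {s : Finset (Fin n)} (hs : s.card = 3) :
    (Q : Measure (SimpleGraph (Fin n))).real (cliqueEvent s) = m
  clique_inter {s t : Finset (Fin n)} (hs : s.card = 3) (ht : t.card = 3)
    (hst : (s ∩ t).card ≤ 1) :
    (Q : Measure (SimpleGraph (Fin n))).real (cliqueEvent s ∩ cliqueEvent t) = m * m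
  clique_inter_le {s t : Finset (Fin n)} (hs : s.card = 3) (ht : t.card = 3)
    (hst : (s ∩ t).card = 2) :
    (Q : Measure (SimpleGraph (Fin n))).real (cliqueEvent s ∩ cliqueEvent t) ≤ p * m

/-- The probability that three independent uniform points of the sphere have pairwise inner
products at least `τ`. -/
noncomputable def sphereTriangleProb (r : ℕ) (τ : ℝ) : ℝ :=
  ((sphereUniform r).prod ((sphereUniform r).prod (sphereUniform r))).real
    {z | τ ≤ inner ℝ z.1.1 z.2.1.1 ∧ τ ≤ inner ℝ z.1.1 z.2.2.1 ∧ τ ≤ inner ℝ z.2.1.1 z.2.2.1}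

/-- The probability that two independent uniform points of the sphere have inner product
at least `τ`. -/
noncomputable def sphereEdgeProb (r : ℕ) (τ : ℝ) : ℝ :=
  ((sphereUniform r).prod (sphereUniform r)).real {z | τ ≤ inner ℝ z.1.1 z.2.1}

lemma sphereUniform_cap {r : ℕ} (hr : 1 ≤ r) (τ : ℝ)
    (x : Metric.sphere (0 : EuclideanSpace ℝ (Fin r)) 1) :
    sphereUniform r {z | τ ≤ inner ℝ z.1 x.1} = ENNReal.ofReal (sphereEdgeProb r τ) := by
  have := isProbabilityMeasure_sphereUniform hr
  rw [sphereEdgeProb, ofReal_measureReal, Measure.prod_apply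
    (measurableSet_inner τ measurable_fst measurable_snd)]
  have h (y : Metric.sphere (0 : EuclideanSpace ℝ (Fin r)) 1) :
      sphereUniform r (Prod.mk y ⁻¹' {z | τ ≤ inner ℝ z.1.1 z.2.1}) =
        sphereUniform r {z | τ ≤ inner ℝ z.1 x.1} := by
    rw [sphereUniform_cap_eq τ x y]
    simp only [Set.preimage_ofPred_eq, real_inner_comm]
  simp only [h, lintegral_const, measure_univ, mul_one]

lemma sphereUniform_triangle {r : ℕ} (hr : 1 ≤ r) (τ : ℝ)
    (x : Metric.sphere (0 : EuclideanSpace ℝ (Fin r)) 1) :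
    ((sphereUniform r).prod (sphereUniform r)) {z | τ ≤ inner ℝ x.1 z.1.1 ∧
      τ ≤ inner ℝ x.1 z.2.1 ∧ τ ≤ inner ℝ z.1.1 z.2.1} =
    ENNReal.ofReal (sphereTriangleProb r τ) := by
  have := isProbabilityMeasure_sphereUniform hr
  have hT : MeasurableSet {z : Metric.sphere (0 : EuclideanSpace ℝ (Fin r)) 1 ×
      Metric.sphere (0 : EuclideanSpace ℝ (Fin r)) 1 ×
        Metric.sphere (0 : EuclideanSpace ℝ (Fin r)) 1 | τ ≤ inner ℝ z.1.1 z.2.1.1 ∧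
        τ ≤ inner ℝ z.1.1 z.2.2.1 ∧ τ ≤ inner ℝ z.2.1.1 z.2.2.1} :=
    (measurableSet_inner τ (by fun_prop) (by fun_prop)).inter
      ((measurableSet_inner τ (by fun_prop) (by fun_prop)).inter
        (measurableSet_inner τ (by fun_prop) (by fun_prop)))
  rw [sphereTriangleProb, ofReal_measureReal, Measure.prod_apply hT]
  have h (y : Metric.sphere (0 : EuclideanSpace ℝ (Fin r)) 1) :
      ((sphereUniform r).prod (sphereUniform r)) (Prod.mk y ⁻¹' {z |
        τ ≤ inner ℝ z.1.1 z.2.1.1 ∧ τ ≤ inner ℝ z.1.1 z.2.2.1 ∧ τ ≤ inner ℝ z.2.1.1 z.2.2.1}) =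
      ((sphereUniform r).prod (sphereUniform r)) {z | τ ≤ inner ℝ x.1 z.1.1 ∧
        τ ≤ inner ℝ x.1 z.2.1 ∧ τ ≤ inner ℝ z.1.1 z.2.1} := by
    rw [sphereUniform_triangle_eq τ x y]
    simp only [Set.preimage_ofPred_eq]
  simp only [h, lintegral_const, measure_univ, mul_one]

lemma edgeTriangleLaw_of_map {n r : ℕ} (hr : 1 ≤ r) (τ : ℝ) {Q : GraphDist n}
    (hQ : (Q : Measure (SimpleGraph (Fin n))) =
      Measure.map (geomGraph τ) (Measure.pi fun _ : Fin n => sphereUniform r)) :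
    EdgeTriangleLaw Q (sphereEdgeProb r τ) (sphereTriangleProb r τ) := by
  have := isProbabilityMeasure_sphereUniform hr
  have hR : MeasurableSet {z : Metric.sphere (0 : EuclideanSpace ℝ (Fin r)) 1 ×
      Metric.sphere (0 : EuclideanSpace ℝ (Fin r)) 1 | τ ≤ inner ℝ z.1.1 z.2.1} :=
    measurableSet_inner τ measurable_fst measurable_snd
  have hs (x y : Metric.sphere (0 : EuclideanSpace ℝ (Fin r)) 1)
      (h : τ ≤ inner ℝ x.1 y.1) : τ ≤ inner ℝ y.1 x.1 := by rwa [real_inner_comm]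
  have hp := sphereUniform_cap hr τ
  have hm := sphereUniform_triangle hr τ
  have hp0 : 0 ≤ sphereEdgeProb r τ := measureReal_nonneg
  have hm0 : 0 ≤ sphereTriangleProb r τ := measureReal_nonneg
  have hadj {i j : Fin n} (hij : i ≠ j) : (geomGraph τ : (Fin n →
      Metric.sphere (0 : EuclideanSpace ℝ (Fin r)) 1) → _) ⁻¹' {G | G.Adj i j} =
        {x | τ ≤ inner ℝ (x i).1 (x j).1} := by
    ext x; simp [geomGraph, hij]
  have hadjm (i j : Fin n) : MeasurableSet {x : Fin n →
      Metric.sphere (0 : EuclideanSpace ℝ (Fin r)) 1 | τ ≤ inner ℝ (x i).1 (x j).1} :=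
    measurableSet_inner τ (measurable_pi_apply i) (measurable_pi_apply j)
  have e1 {i j : Fin n} (hij : i ≠ j) : (Measure.pi fun _ : Fin n => sphereUniform r)
      {x | τ ≤ inner ℝ (x i).1 (x j).1} = ENNReal.ofReal (sphereEdgeProb r τ) := by
    simpa using pi_edge_inter (sphereUniform r) hR hp hij MeasurableSet.univ (by simp)
  have e2 {i j k l : Fin n} (hij : i ≠ j) (hkl : k ≠ l) (hik : i ≠ k) (hil : i ≠ l) :
      (Measure.pi fun _ : Fin n => sphereUniform r)
      ({x | τ ≤ inner ℝ (x i).1 (x j).1} ∩ {x | τ ≤ inner ℝ (x k).1 (x l).1}) =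
        ENNReal.ofReal (sphereEdgeProb r τ * sphereEdgeProb r τ) := by
    rw [pi_edge_inter (sphereUniform r) hR hp hij (hadjm k l) (by
      intro x y
      simp [Function.update_of_ne hik.symm, Function.update_of_ne hil.symm]), e1 hkl,
      ENNReal.ofReal_mul hp0]
  constructor
  · intro i j k l hij hkl hne hne'
    rw [measureReal_def, hQ, Measure.map_apply (measurable_geomGraph τ)
      ((measurableSet_adj i j).inter (measurableSet_adj k l)), Set.preimage_inter, hadj hij,
      hadj hkl]
    rw [← ENNReal.toReal_ofReal (mul_nonneg hp0 hp0)]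
    congr 1
    by_cases h : i ≠ k ∧ i ≠ l
    · exact e2 hij hkl h.1 h.2
    · have hsw : {x : Fin n → Metric.sphere (0 : EuclideanSpace ℝ (Fin r)) 1 |
          τ ≤ inner ℝ (x i).1 (x j).1} = {x | τ ≤ inner ℝ (x j).1 (x i).1} := by
        simp only [real_inner_comm]
      rw [hsw]
      have : j ≠ k ∧ j ≠ l := by
        constructor <;> rintro rfl <;> simp_all
      exact e2 hij.symm hkl this.1 this.2
  · intro i j hij
    rw [measureReal_def, hQ, Measure.map_apply (measurable_geomGraph τ) (measurableSet_adj i j),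
      hadj hij, e1 hij, ENNReal.toReal_ofReal hp0]
  · intro s h
    rw [measureReal_def, hQ, Measure.map_apply (measurable_geomGraph τ)
      (measurableSet_cliqueEvent s), geomGraph_preimage_cliqueEvent, pi_labelClique hR hs hm h,
      ENNReal.toReal_ofReal hm0]
  · intro s t h h' hst
    rw [measureReal_def, hQ, Measure.map_apply (measurable_geomGraph τ)
      ((measurableSet_cliqueEvent s).inter (measurableSet_cliqueEvent t)), Set.preimage_inter,
      geomGraph_preimage_cliqueEvent, geomGraph_preimage_cliqueEvent,
      pi_labelClique_inter_of_card_le_one hR hs hm h h' hst, ENNReal.toReal_mul,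
      ENNReal.toReal_ofReal hm0]
  · intro s t h h' hst
    rw [measureReal_def, hQ, Measure.map_apply (measurable_geomGraph τ)
      ((measurableSet_cliqueEvent s).inter (measurableSet_cliqueEvent t)), Set.preimage_inter,
      geomGraph_preimage_cliqueEvent, geomGraph_preimage_cliqueEvent]
    refine ENNReal.toReal_le_of_le_ofReal (mul_nonneg hp0 hm0) ?_
    rw [ENNReal.ofReal_mul hp0]
    exact pi_labelClique_inter_of_card_eq_two hR hs hp hm h h' hst

/-! ### Chebyshev bounds for the edge density and the triangle density -/

section Chebyshev

variable {Ω ι : Type*} [MeasurableSpace Ω] {P : Measure Ω} [IsProbabilityMeasure P]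
  {I : Finset ι} {A : ι → Set Ω} {m : ℝ}

lemma integrable_indicator_one (hA : ∀ s, MeasurableSet (A s)) (s : ι) :
    Integrable ((A s).indicator (1 : Ω → ℝ)) P :=
  (integrable_const (1 : ℝ)).indicator (hA s)

lemma integral_average_indicator (hA : ∀ s, MeasurableSet (A s)) (hI : I.Nonempty)
    (h1 : ∀ s ∈ I, P.real (A s) = m) :
    ∫ ω, (I.card : ℝ)⁻¹ * ∑ s ∈ I, (A s).indicator (1 : Ω → ℝ) ω ∂P = m := by
  rw [integral_const_mul, integral_finsetSum _ fun s _ => integrable_indicator_one hA s,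
    Finset.sum_congr rfl fun s hs => (integral_indicator_one (hA s)).trans (h1 s hs),
    Finset.sum_const, nsmul_eq_mul, inv_mul_cancel_left₀]
  exact_mod_cast hI.card_pos.ne'

/-- Chebyshev's inequality for the average of indicators of events of probability `m`, with an
upper bound `c s t` for the covariances. -/
lemma measure_average_indicator_le (hA : ∀ s, MeasurableSet (A s)) (hI : I.Nonempty)
    (h1 : ∀ s ∈ I, P.real (A s) = m) {c : ι → ι → ℝ}
    (h2 : ∀ s ∈ I, ∀ t ∈ I, P.real (A s ∩ A t) ≤ m * m + c s t) {V : ℝ}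
    (hV : ∑ s ∈ I, ∑ t ∈ I, c s t ≤ I.card * V) {ε : ℝ} (hε : 0 < ε) :
    P {ω | ε ≤ |(I.card : ℝ)⁻¹ * ∑ s ∈ I, (A s).indicator (1 : Ω → ℝ) ω - m|} ≤
      ENNReal.ofReal (V / (I.card * ε ^ 2)) := by
  have hcard : (0 : ℝ) < I.card := by exact_mod_cast hI.card_pos
  have hL (s : ι) : MemLp ((A s).indicator (1 : Ω → ℝ)) 2 P :=
    (memLp_const (1 : ℝ)).indicator (hA s)
  have hLsum : MemLp (fun ω => ∑ s ∈ I, (A s).indicator (1 : Ω → ℝ) ω) 2 P :=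
    memLp_finsetSum _ fun s _ => hL s
  have hLf : MemLp (fun ω => (I.card : ℝ)⁻¹ * ∑ s ∈ I, (A s).indicator (1 : Ω → ℝ) ω) 2 P :=
    hLsum.const_mul _
  have hvar : ProbabilityTheory.variance
      (fun ω => (I.card : ℝ)⁻¹ * ∑ s ∈ I, (A s).indicator (1 : Ω → ℝ) ω) P ≤ V / I.card := by
    rw [ProbabilityTheory.variance_const_mul, ProbabilityTheory.variance_fun_sum' fun s _ => hL s]
    have hcov : ∀ s ∈ I, ∀ t ∈ I, ProbabilityTheory.covariance ((A s).indicator (1 : Ω → ℝ))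
        ((A t).indicator (1 : Ω → ℝ)) P ≤ c s t := by
      intro s hs t ht
      rw [ProbabilityTheory.covariance_eq_sub (hL s) (hL t), ← Set.inter_indicator_one,
        integral_indicator_one ((hA s).inter (hA t)), integral_indicator_one (hA s),
        integral_indicator_one (hA t), h1 s hs, h1 t ht]
      linarith [h2 s hs t ht]
    calc _ ≤ ((I.card : ℝ)⁻¹) ^ 2 * (I.card * V) := by
          gcongr
          exact (Finset.sum_le_sum fun s hs =>
            Finset.sum_le_sum fun t ht => hcov s hs t ht).trans hV
      _ = V / I.card := by field_simp
  have h := ProbabilityTheory.meas_ge_le_variance_div_sq hLf hε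
  rw [integral_average_indicator hA hI h1] at h
  refine h.trans (ENNReal.ofReal_le_ofReal ?_)
  rw [← div_div]
  gcongr

end Chebyshev

section Densities

variable {n : ℕ}

lemma sum_triples {M : Type*} [AddCommMonoid M] (F : Finset (Fin n) → M) :
    ∑ i : Fin n, ∑ j ∈ Finset.Ioi i, ∑ k ∈ Finset.Ioi j, F {i, j, k} =
      ∑ s ∈ Finset.powersetCard 3 Finset.univ, F s := by
  simp only [Finset.sum_sigma']
  refine Finset.sum_bij (fun a _ => {a.1, a.2.1, a.2.2}) ?_ ?_ ?_ ?_
  · rintro ⟨i, j, k⟩ h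
    simp only [Finset.mem_sigma, Finset.mem_univ, Finset.mem_Ioi, true_and] at h
    rw [Finset.mem_powersetCard]
    exact ⟨Finset.subset_univ _,
      Finset.card_eq_three.2 ⟨i, j, k, h.1.ne, (h.1.trans h.2).ne, h.2.ne, rfl⟩⟩
  · rintro ⟨i, j, k⟩ h ⟨i', j', k'⟩ h' heq
    simp only [Finset.mem_sigma, Finset.mem_univ, Finset.mem_Ioi, true_and] at h h'
    have a1 : i ∈ ({i', j', k'} : Finset (Fin n)) := heq ▸ (by simp)
    have a2 : j ∈ ({i', j', k'} : Finset (Fin n)) := heq ▸ (by simp)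
    have a3 : k ∈ ({i', j', k'} : Finset (Fin n)) := heq ▸ (by simp)
    simp only [Finset.mem_insert, Finset.mem_singleton, Fin.ext_iff, Fin.lt_def] at a1 a2 a3 h h'
    have : i = i' ∧ j = j' ∧ k = k' := by
      simp only [Fin.ext_iff]
      omega
    obtain ⟨rfl, rfl, rfl⟩ := this
    rfl
  · intro s hs
    rw [Finset.mem_powersetCard] at hs
    have hi (a : Fin 3) := Finset.orderEmbOfFin_mem s hs.2 a
    refine ⟨⟨s.orderEmbOfFin hs.2 0, s.orderEmbOfFin hs.2 1, s.orderEmbOfFin hs.2 2⟩, ?_, ?_⟩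
    · simp
    · refine Finset.eq_of_subset_of_card_le ?_ ?_
      · intro a
        simp only [Finset.mem_insert, Finset.mem_singleton]
        rintro (rfl | rfl | rfl) <;> apply hi
      · exact hs.2.trans_le (Finset.card_eq_three.2 ⟨s.orderEmbOfFin hs.2 0,
          s.orderEmbOfFin hs.2 1, s.orderEmbOfFin hs.2 2, by simp, by simp, by simp, rfl⟩).ge
  · intros; rfl

lemma fTri_eq (G : SimpleGraph (Fin n)) :
    fTri n G = ((Finset.powersetCard 3 (Finset.univ : Finset (Fin n))).card : ℝ)⁻¹ *
      ∑ s ∈ Finset.powersetCard 3 Finset.univ, (cliqueEvent s).indicator 1 G := by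
  rw [fTri, ← sum_triples fun s => (cliqueEvent s).indicator (1 : SimpleGraph (Fin n) → ℝ) G]
  simp only [Finset.card_powersetCard, Finset.card_univ, Fintype.card_fin, one_div]
  congr 1
  refine Finset.sum_congr rfl fun i _ => Finset.sum_congr rfl fun j hj =>
    Finset.sum_congr rfl fun k hk => ?_
  have hij := (Finset.mem_Ioi.1 hj).ne
  have hjk := (Finset.mem_Ioi.1 hk).ne
  have hik := ((Finset.mem_Ioi.1 hj).trans (Finset.mem_Ioi.1 hk)).ne
  have h : G ∈ cliqueEvent {i, j, k} ↔ G.Adj i j ∧ G.Adj j k ∧ G.Adj i k := by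
    simp [cliqueEvent, hij, hjk, hik, hij.symm, hjk.symm, hik.symm, G.adj_comm j i,
      G.adj_comm k i, G.adj_comm k j]
    tauto
  by_cases h1 : G.Adj i j <;> by_cases h2 : G.Adj j k <;> by_cases h3 : G.Adj i k <;>
    simp [adjM, Set.indicator, h, h1, h2, h3]

lemma card_sigma_Ioi :
    ((Finset.univ : Finset (Fin n)).sigma fun i => Finset.Ioi i).card = n.choose 2 := by
  rw [Finset.card_sigma]
  simp only [Fin.card_Ioi]
  rw [Nat.choose_two_right, ← Finset.sum_range_id, ← Finset.sum_range_reflect, Finset.sum_range]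

lemma edgeDensity_eq (G : SimpleGraph (Fin n)) :
    edgeDensity n G = (((Finset.univ : Finset (Fin n)).sigma fun i => Finset.Ioi i).card : ℝ)⁻¹ *
      ∑ e ∈ (Finset.univ : Finset (Fin n)).sigma fun i => Finset.Ioi i,
        ({G : SimpleGraph (Fin n) | G.Adj e.1 e.2}).indicator 1 G := by
  rw [edgeDensity, card_sigma_Ioi, Finset.sum_sigma]
  congr 1

/-- A set of three vertices shares exactly two elements with at most `3 n` others. -/
lemma card_inter_eq_two_le {s : Finset (Fin n)} (hs : s.card = 3) :
    ((Finset.powersetCard 3 (Finset.univ : Finset (Fin n))).filter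
      fun t => (s ∩ t).card = 2).card ≤ 3 * n := by
  have hsub : ((Finset.powersetCard 3 (Finset.univ : Finset (Fin n))).filter
      fun t => (s ∩ t).card = 2) ⊆
      (s ×ˢ (Finset.univ : Finset (Fin n))).image fun e => insert e.2 (s.erase e.1) := by
    intro t ht
    rw [Finset.mem_filter, Finset.mem_powersetCard] at ht
    obtain ⟨⟨_, ht⟩, hst⟩ := ht
    have h1 := Finset.card_sdiff_add_card_inter s t
    have h2 := Finset.card_sdiff_add_card_inter t s
    rw [Finset.inter_comm t s] at h2
    obtain ⟨a, ha⟩ := Finset.card_eq_one.1 (by omega : (s \ t).card = 1)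
    obtain ⟨d, hd⟩ := Finset.card_eq_one.1 (by omega : (t \ s).card = 1)
    have ha' (x : Fin n) : x ∈ s \ t ↔ x = a := by rw [ha, Finset.mem_singleton]
    have hd' (x : Fin n) : x ∈ t \ s ↔ x = d := by rw [hd, Finset.mem_singleton]
    simp only [Finset.mem_sdiff] at ha' hd'
    refine Finset.mem_image.2 ⟨(a, d), ?_, ?_⟩
    · simp [((ha' a).2 rfl).1]
    · ext x
      simp only [Finset.mem_insert, Finset.mem_erase]
      have := ha' x
      have := hd' x
      tauto
  calc _ ≤ _ := Finset.card_le_card hsub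
    _ ≤ _ := Finset.card_image_le
    _ = 3 * n := by simp [hs]

variable {Q : GraphDist n} {p m : ℝ}

lemma EdgeTriangleLaw.edge_nonneg (h : EdgeTriangleLaw Q p m) (hn : 2 ≤ n) : 0 ≤ p := by
  rw [← h.adj (i := ⟨0, by omega⟩) (j := ⟨1, by omega⟩) (by simp)]
  exact measureReal_nonneg

lemma powersetCard_three_nonempty (hn : 3 ≤ n) :
    (Finset.powersetCard 3 (Finset.univ : Finset (Fin n))).Nonempty :=
  Finset.powersetCard_nonempty.2 (by simpa using hn)

lemma EdgeTriangleLaw.muTri_eq (h : EdgeTriangleLaw Q p m) (hn : 3 ≤ n) : muTri n Q = m := by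
  simp only [muTri, fTri_eq]
  exact integral_average_indicator measurableSet_cliqueEvent (powersetCard_three_nonempty hn)
    fun s hs => h.clique (Finset.mem_powersetCard.1 hs).2

lemma EdgeTriangleLaw.tri_nonneg (h : EdgeTriangleLaw Q p m) (hn : 3 ≤ n) : 0 ≤ m := by
  obtain ⟨s, hs⟩ := powersetCard_three_nonempty hn
  rw [← h.clique (Finset.mem_powersetCard.1 hs).2]
  exact measureReal_nonneg

/-- The variance of the triangle density is at most `(3 n p + 1) m / (n choose 3)`. -/
lemma EdgeTriangleLaw.measure_fTri_le (h : EdgeTriangleLaw Q p m) (hn : 3 ≤ n) {ε : ℝ}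
    (hε : 0 < ε) : (Q : Measure (SimpleGraph (Fin n))) {G | ε ≤ |fTri n G - m|} ≤
      ENNReal.ofReal ((3 * n * p + 1) * m / (n.choose 3 * ε ^ 2)) := by
  have hp := h.edge_nonneg (by omega)
  have hm := h.tri_nonneg hn
  have hcard : (Finset.powersetCard 3 (Finset.univ : Finset (Fin n))).card = n.choose 3 := by simp
  simp only [fTri_eq]
  rw [← hcard]
  refine measure_average_indicator_le (I := Finset.powersetCard 3 (Finset.univ : Finset (Fin n)))
    (A := cliqueEvent) (c := fun s t => (if (s ∩ t).card = 2 then p * m else 0) +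
      if s = t then m else 0) measurableSet_cliqueEvent
    (powersetCard_three_nonempty hn) (fun s hs => h.clique (Finset.mem_powersetCard.1 hs).2)
    ?_ ?_ hε
  · intro s hs t ht
    have hs := (Finset.mem_powersetCard.1 hs).2
    have ht := (Finset.mem_powersetCard.1 ht).2
    have hmm := mul_nonneg hm hm
    by_cases h1 : (s ∩ t).card ≤ 1
    · rw [h.clique_inter hs ht h1]
      have : 0 ≤ (if (s ∩ t).card = 2 then p * m else 0) + if s = t then m else 0 := by positivity
      linarith
    by_cases h2 : (s ∩ t).card = 2
    · have h3 : s ≠ t := by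
        rintro rfl
        rw [Finset.inter_self] at h2
        omega
      rw [if_pos h2, if_neg h3]
      linarith [h.clique_inter_le hs ht h2]
    · have hle := Finset.card_le_card (Finset.inter_subset_left (s₁ := s) (s₂ := t))
      have hst : s = t := by
        have e1 := Finset.eq_of_subset_of_card_le (Finset.inter_subset_left (s₁ := s) (s₂ := t))
          (by omega)
        have e2 := Finset.eq_of_subset_of_card_le (Finset.inter_subset_right (s₁ := s) (s₂ := t))
          (by omega)
        exact e1.symm.trans e2
      subst hst
      rw [if_neg h2, if_pos rfl, Set.inter_self, h.clique hs]
      linarith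
  · rw [← nsmul_eq_mul]
    refine Finset.sum_le_card_nsmul _ _ _ fun s hs => ?_
    rw [Finset.sum_add_distrib, Finset.sum_ite_eq, if_pos hs, ← Finset.sum_filter,
      Finset.sum_const, nsmul_eq_mul]
    have h3 : (((Finset.powersetCard 3 (Finset.univ : Finset (Fin n))).filter
        fun t => (s ∩ t).card = 2).card : ℝ) ≤ 3 * n := by
      exact_mod_cast card_inter_eq_two_le (Finset.mem_powersetCard.1 hs).2
    nlinarith [mul_le_mul_of_nonneg_right h3 (mul_nonneg hp hm)]

/-- The edges are pairwise independent, so the variance of the edge density is at most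
`p / (n choose 2)`. -/
lemma EdgeTriangleLaw.measure_edgeDensity_le (h : EdgeTriangleLaw Q p m) (hn : 2 ≤ n) {ε : ℝ}
    (hε : 0 < ε) : (Q : Measure (SimpleGraph (Fin n))) {G | ε ≤ |edgeDensity n G - p|} ≤
      ENNReal.ofReal (p / (n.choose 2 * ε ^ 2)) := by
  have hp := h.edge_nonneg hn
  simp only [edgeDensity_eq]
  rw [← card_sigma_Ioi]
  refine measure_average_indicator_le
    (I := (Finset.univ : Finset (Fin n)).sigma fun i => Finset.Ioi i)
    (A := fun e => {G : SimpleGraph (Fin n) | G.Adj e.1 e.2})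
    (c := fun s t => if s = t then p else 0) (fun e => measurableSet_adj e.1 e.2) ?_ ?_ ?_ ?_ hε
  · rw [← Finset.card_pos, card_sigma_Ioi]
    exact Nat.choose_pos hn
  · intro e he
    exact h.adj (Finset.mem_Ioi.1 (Finset.mem_sigma.1 he).2).ne
  · rintro ⟨i, j⟩ he ⟨k, l⟩ he'
    simp only [Finset.mem_sigma, Finset.mem_univ, Finset.mem_Ioi, true_and] at he he'
    by_cases heq : i = k ∧ j = l
    · obtain ⟨rfl, rfl⟩ := heq
      rw [if_pos rfl, Set.inter_self, h.adj he.ne]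
      nlinarith
    · rw [if_neg (by simpa using heq), h.adj_inter he.ne he'.ne (by tauto) (by
        by_contra! hcon
        exact absurd (hcon.1 ▸ hcon.2 ▸ he : l < k) he'.not_gt)]
      linarith
  · simp +contextual [Finset.sum_ite_eq]

end Densities

/-! ### Latitude decomposition of the uniform distribution on the sphere -/

/-- The point of `ℝ^(k+1)` with first coordinate `a` and remaining coordinates `b`. -/
def consVec {k : ℕ} (a : ℝ) (b : EuclideanSpace ℝ (Fin k)) : EuclideanSpace ℝ (Fin (k + 1)) :=
  WithLp.toLp 2 (Fin.cons a b.ofLp)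

lemma inner_consVec {k : ℕ} (a a' : ℝ) (b b' : EuclideanSpace ℝ (Fin k)) :
    inner ℝ (consVec a b) (consVec a' b') = a * a' + inner ℝ b b' := by
  simp only [consVec, PiLp.inner_apply, Fin.sum_univ_succ, Fin.cons_zero, Fin.cons_succ]
  simp [mul_comm]

lemma norm_consVec_sq {k : ℕ} (a : ℝ) (b : EuclideanSpace ℝ (Fin k)) :
    ‖consVec a b‖ ^ 2 = a ^ 2 + ‖b‖ ^ 2 := by
  rw [← real_inner_self_eq_norm_sq, inner_consVec, real_inner_self_eq_norm_sq]
  ring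

lemma smul_consVec {k : ℕ} (c a : ℝ) (b : EuclideanSpace ℝ (Fin k)) :
    c • consVec a b = consVec (c * a) (c • b) := by
  ext i
  refine Fin.cases ?_ (fun j => ?_) i <;> simp [consVec]

lemma measurePreserving_consVec (k : ℕ) :
    MeasurePreserving (fun z : ℝ × EuclideanSpace ℝ (Fin k) => consVec z.1 z.2)
      (volume.prod volume) volume := by
  have h1 : MeasurePreserving
      (Prod.map id WithLp.ofLp : ℝ × EuclideanSpace ℝ (Fin k) → ℝ × (Fin k → ℝ))
      (volume.prod volume) (volume.prod volume) :=
    (MeasurePreserving.id volume).prod (PiLp.volume_preserving_ofLp (Fin k))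
  have h2 := (volume_preserving_piFinSuccAbove (fun _ : Fin (k + 1) => ℝ) 0).symm
  have h3 := (PiLp.volume_preserving_toLp (Fin (k + 1))).comp (h2.comp h1)
  convert! h3 using 1
  ext z i
  simp [consVec, MeasurableEquiv.piFinSuccAbove, Fin.insertNthEquiv]

lemma measurable_consVec (k : ℕ) :
    Measurable fun z : ℝ × EuclideanSpace ℝ (Fin k) => consVec z.1 z.2 :=
  (measurePreserving_consVec k).measurable

/-- Polar coordinates for the volume of a set. -/
lemma volume_eq_polar {k : ℕ} (hk : 1 ≤ k) {B : Set (EuclideanSpace ℝ (Fin k))}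
    (hB : MeasurableSet B) :
    volume B = ((volume : Measure (EuclideanSpace ℝ (Fin k))).toSphere.prod
      (Measure.volumeIoiPow (k - 1))) {z | z.2.1 • z.1.1 ∈ B} := by
  have : Nonempty (Fin k) := ⟨⟨0, hk⟩⟩
  have : Nontrivial (EuclideanSpace ℝ (Fin k)) := inferInstance
  have hp :=
    (volume : Measure (EuclideanSpace ℝ (Fin k))).measurePreserving_homeomorphUnitSphereProd
  rw [finrank_euclideanSpace_fin] at hp
  have hmeas : MeasurableSet {z : Metric.sphere (0 : EuclideanSpace ℝ (Fin k)) 1 × Set.Ioi (0 : ℝ) |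
      z.2.1 • z.1.1 ∈ B} := by
    refine measurableSet_preimage (f := fun z : Metric.sphere (0 : EuclideanSpace ℝ (Fin k)) 1 ×
      Set.Ioi (0 : ℝ) => z.2.1 • z.1.1) ?_ hB
    fun_prop
  rw [← hp.measure_preimage hmeas.nullMeasurableSet,
    (MeasurableEmbedding.subtype_coe (measurableSet_singleton _).compl).comap_apply]
  rw [← measure_sdiff_null (s := B) (measure_singleton (0 : EuclideanSpace ℝ (Fin k)))]
  congr 1
  ext x
  simp only [Set.mem_sdiff, Set.mem_singleton_iff, Set.mem_image, Set.mem_preimage,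
    Set.mem_ofPred_eq, Subtype.exists, exists_and_right, exists_eq_right, ←
    homeomorphUnitSphereProd_symm_apply_coe, Homeomorph.symm_apply_apply]
  constructor
  · rintro ⟨h, h0⟩
    exact ⟨h0, h⟩
  · rintro ⟨h0, h⟩
    exact ⟨h, h0⟩

/-- The sine of the latitude of the point `(a, R w)`, where `w` is a unit vector. -/
noncomputable def lat (z : ℝ × Set.Ioi (0 : ℝ)) : ℝ := z.1 / √(z.1 ^ 2 + z.2.1 ^ 2)

/-- The cosine of the latitude of the point `(a, R w)`, where `w` is a unit vector. -/
noncomputable def colat (z : ℝ × Set.Ioi (0 : ℝ)) : ℝ := z.2.1 / √(z.1 ^ 2 + z.2.1 ^ 2)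

lemma lat_norm_pos (z : ℝ × Set.Ioi (0 : ℝ)) : 0 < z.1 ^ 2 + z.2.1 ^ 2 := by
  have : 0 < z.2.1 := z.2.2
  positivity

lemma colat_pos (z : ℝ × Set.Ioi (0 : ℝ)) : 0 < colat z :=
  div_pos z.2.2 (Real.sqrt_pos.2 (lat_norm_pos z))

lemma lat_sq_add_colat_sq (z : ℝ × Set.Ioi (0 : ℝ)) : lat z ^ 2 + colat z ^ 2 = 1 := by
  rw [lat, colat, div_pow, div_pow, Real.sq_sqrt (lat_norm_pos z).le, ← add_div,
    div_self (lat_norm_pos z).ne']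

@[fun_prop]
lemma measurable_lat : Measurable lat := by unfold lat; fun_prop

@[fun_prop]
lemma measurable_colat : Measurable colat := by unfold colat; fun_prop

/-- The point of the sphere with first coordinate `lat z` in the meridian of `w`. -/
noncomputable def latLift {k : ℕ} (z : ℝ × Set.Ioi (0 : ℝ))
    (w : Metric.sphere (0 : EuclideanSpace ℝ (Fin k)) 1) :
    Metric.sphere (0 : EuclideanSpace ℝ (Fin (k + 1))) 1 :=
  ⟨consVec (lat z) (colat z • w.1), by
    have hw : ‖w.1‖ = 1 := by simp
    have h := norm_consVec_sq (lat z) (colat z • w.1)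
    rw [norm_smul, hw, mul_one, Real.norm_eq_abs, sq_abs, lat_sq_add_colat_sq] at h
    rw [mem_sphere_zero_iff_norm]
    nlinarith [norm_nonneg (consVec (lat z) (colat z • w.1))]⟩

lemma measurable_latLift (k : ℕ) : Measurable
    fun x : (ℝ × Set.Ioi (0 : ℝ)) × Metric.sphere (0 : EuclideanSpace ℝ (Fin k)) 1 =>
      latLift x.1 x.2 := by
  refine Measurable.subtype_mk ?_
  exact (measurable_consVec k).comp (f := fun x : (ℝ × Set.Ioi (0 : ℝ)) ×
    Metric.sphere (0 : EuclideanSpace ℝ (Fin k)) 1 => (lat x.1, colat x.1 • x.2.1)) (by fun_prop)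

/-- The part `a ^ 2 + R ^ 2 < 1` of the half plane with coordinates `(a, R)`, weighted
with `R ^ (k - 1)`: the image of Lebesgue measure on the unit ball of `ℝ^(k+1)`. -/
noncomputable def halfDisc (k : ℕ) : Measure (ℝ × Set.Ioi (0 : ℝ)) :=
  ((volume : Measure ℝ).prod (Measure.volumeIoiPow (k - 1))).restrict {z | z.1 ^ 2 + z.2.1 ^ 2 < 1}

instance (k : ℕ) : SFinite (halfDisc k) := by unfold halfDisc; infer_instance

lemma measurableSet_halfDisc :
    MeasurableSet {z : ℝ × Set.Ioi (0 : ℝ) | z.1 ^ 2 + z.2.1 ^ 2 < 1} :=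
  measurableSet_lt (by fun_prop) measurable_const

lemma homeomorphUnitSphereProd_consVec {k : ℕ} (z : ℝ × Set.Ioi (0 : ℝ))
    (w : Metric.sphere (0 : EuclideanSpace ℝ (Fin k)) 1) :
    consVec z.1 (z.2.1 • w.1) = ((homeomorphUnitSphereProd (EuclideanSpace ℝ (Fin (k + 1)))).symm
      (latLift z w, ⟨√(z.1 ^ 2 + z.2.1 ^ 2), Real.sqrt_pos.2 (lat_norm_pos z)⟩)).1 := by
  rw [homeomorphUnitSphereProd_symm_apply_coe]
  have h := (Real.sqrt_pos.2 (lat_norm_pos z)).ne'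
  simp only [latLift, smul_consVec, smul_smul, lat, colat]
  rw [mul_div_cancel₀ _ h, mul_div_cancel₀ _ h]

/-- Polar coordinates in `ℝ^(k+1)` and in its subspace `ℝ^k`, compared on the unit ball
of `ℝ^(k+1)`. -/
lemma toSphere_succ {k : ℕ} (hk : 1 ≤ k) :
    (volume : Measure (EuclideanSpace ℝ (Fin (k + 1)))).toSphere = ((k : ℝ≥0∞) + 1) •
      Measure.map (fun x : (ℝ × Set.Ioi (0 : ℝ)) ×
        Metric.sphere (0 : EuclideanSpace ℝ (Fin k)) 1 => latLift x.1 x.2)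
      ((halfDisc k).prod (volume : Measure (EuclideanSpace ℝ (Fin k))).toSphere) := by
  ext s hs
  have hp :=
    (volume : Measure (EuclideanSpace ℝ (Fin (k + 1)))).measurePreserving_homeomorphUnitSphereProd
  rw [finrank_euclideanSpace_fin, Nat.add_sub_cancel] at hp
  set T : Set ({0}ᶜ : Set (EuclideanSpace ℝ (Fin (k + 1)))) :=
    homeomorphUnitSphereProd _ ⁻¹' (s ×ˢ Set.Iio ⟨1, Set.mem_Ioi.2 one_pos⟩) with hT
  have hTm : MeasurableSet T :=
    (Homeomorph.measurable _) (hs.prod measurableSet_Iio)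
  have hemb := MeasurableEmbedding.subtype_coe
    (measurableSet_singleton (0 : EuclideanSpace ℝ (Fin (k + 1)))).compl
  have hvol : volume (Subtype.val '' T) =
      (volume : Measure (EuclideanSpace ℝ (Fin (k + 1)))).toSphere s * ((k : ℝ≥0∞) + 1)⁻¹ := by
    rw [← hemb.comap_apply, hT, hp.measure_preimage (hs.prod measurableSet_Iio).nullMeasurableSet,
      Measure.prod_prod, Measure.volumeIoiPow_apply_Iio]
    congr 1
    rw [one_pow, one_div, ENNReal.ofReal_inv_of_pos (by positivity)]
    norm_cast
  have hmem (a : ℝ) (w : Metric.sphere (0 : EuclideanSpace ℝ (Fin k)) 1) (R : Set.Ioi (0 : ℝ)) :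
      consVec a (R.1 • w.1) ∈ Subtype.val '' T ↔ a ^ 2 + R.1 ^ 2 < 1 ∧ latLift (a, R) w ∈ s := by
    rw [homeomorphUnitSphereProd_consVec (a, R), Subtype.val_injective.mem_set_image, hT,
      Set.mem_preimage, Homeomorph.apply_symm_apply, Set.mem_prod, Set.mem_Iio, and_comm]
    refine and_congr_left fun _ => ?_
    rw [← Subtype.coe_lt_coe, Real.sqrt_lt' one_pos, one_pow]
  have hAm := hemb.measurableSet_image.2 hTm
  have hlm := measurable_latLift k hs
  rw [Measure.smul_apply, Measure.map_apply (measurable_latLift k) hs, smul_eq_mul,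
    Measure.prod_apply hlm, halfDisc, ← lintegral_indicator measurableSet_halfDisc,
    lintegral_prod _ ((measurable_measure_prodMk_left hlm).indicator
      measurableSet_halfDisc).aemeasurable]
  have key : volume (Subtype.val '' T) = ∫⁻ a : ℝ, ∫⁻ R, {z : ℝ × Set.Ioi (0 : ℝ) |
      z.1 ^ 2 + z.2.1 ^ 2 < 1}.indicator
        (fun z => (volume : Measure (EuclideanSpace ℝ (Fin k))).toSphere
        (Prod.mk z ⁻¹' ((fun x : (ℝ × Set.Ioi (0 : ℝ)) ×
          Metric.sphere (0 : EuclideanSpace ℝ (Fin k)) 1 => latLift x.1 x.2) ⁻¹' s))) (a, R)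
          ∂(Measure.volumeIoiPow (k - 1)) := by
    rw [← (measurePreserving_consVec k).measure_preimage hAm.nullMeasurableSet,
      Measure.prod_apply (measurable_consVec k hAm)]
    refine lintegral_congr fun a => ?_
    have hsec := measurable_prodMk_left (x := a) (measurable_consVec k hAm)
    have hpol : MeasurableSet {z : Metric.sphere (0 : EuclideanSpace ℝ (Fin k)) 1 ×
        Set.Ioi (0 : ℝ) |
        z.2.1 • z.1.1 ∈ Prod.mk a ⁻¹' ((fun z : ℝ × EuclideanSpace ℝ (Fin k) =>
          consVec z.1 z.2) ⁻¹' (Subtype.val '' T))} :=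
      measurableSet_preimage (f := fun z : Metric.sphere (0 : EuclideanSpace ℝ (Fin k)) 1 ×
        Set.Ioi (0 : ℝ) => z.2.1 • z.1.1) (by fun_prop) hsec
    rw [volume_eq_polar hk hsec, Measure.prod_apply_symm hpol]
    refine lintegral_congr fun R => ?_
    by_cases h : a ^ 2 + R.1 ^ 2 < 1
    · rw [Set.indicator_of_mem (by exact h)]
      congr 1
      ext w
      simp only [Set.mem_preimage, Set.mem_ofPred_eq]
      rw [hmem]
      simp [h]
    · rw [Set.indicator_of_notMem (by exact h)]
      refine (congrArg _ (Set.eq_empty_iff_forall_notMem.2 fun w => ?_)).trans measure_empty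
      simp only [Set.mem_preimage, Set.mem_ofPred_eq]
      rw [hmem]
      simp [h]
  rw [← key, hvol, mul_left_comm, ENNReal.mul_inv_cancel (by simp) (by finiteness), mul_one]

/-- The distribution of `(a, R)` for a uniform point `(a, R w)` of the unit ball of `ℝ^(k+1)`. -/
noncomputable def latMeasure (k : ℕ) : Measure (ℝ × Set.Ioi (0 : ℝ)) :=
  (halfDisc k Set.univ)⁻¹ • halfDisc k

instance (k : ℕ) : SFinite (latMeasure k) := by unfold latMeasure; infer_instance

/-- A uniform point of the sphere of `ℝ^(k+1)` has a meridian that is uniform on the sphere of `ℝ^k`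
and independent of its latitude. -/
theorem sphereUniform_succ {k : ℕ} (hk : 1 ≤ k) :
    IsProbabilityMeasure (latMeasure k) ∧ sphereUniform (k + 1) =
      Measure.map (fun x : (ℝ × Set.Ioi (0 : ℝ)) ×
        Metric.sphere (0 : EuclideanSpace ℝ (Fin k)) 1 => latLift x.1 x.2)
      ((latMeasure k).prod (sphereUniform k)) := by
  have hP := isProbabilityMeasure_sphereUniform hk
  have hP' := isProbabilityMeasure_sphereUniform (r := k + 1) (by omega)
  have h0 : (volume : Measure (EuclideanSpace ℝ (Fin k))).toSphere Set.univ ≠ 0 := by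
    have : Nonempty (Fin k) := ⟨⟨0, hk⟩⟩
    have : Nontrivial (EuclideanSpace ℝ (Fin k)) := inferInstance
    rw [Ne, Measure.measure_univ_eq_zero]
    exact Measure.toSphere_ne_zero _
  have ht : (volume : Measure (EuclideanSpace ℝ (Fin k))).toSphere =
      (volume : Measure (EuclideanSpace ℝ (Fin k))).toSphere Set.univ • sphereUniform k := by
    rw [sphereUniform, smul_smul, ENNReal.mul_inv_cancel h0 (measure_ne_top _ _), one_smul]
  obtain ⟨c, hc⟩ : ∃ c : ℝ≥0∞, sphereUniform (k + 1) = c •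
      Measure.map (fun x : (ℝ × Set.Ioi (0 : ℝ)) ×
        Metric.sphere (0 : EuclideanSpace ℝ (Fin k)) 1 => latLift x.1 x.2)
      ((halfDisc k).prod (sphereUniform k)) := by
    rw [sphereUniform]
    generalize ((volume : Measure (EuclideanSpace ℝ (Fin (k + 1)))).toSphere Set.univ)⁻¹ = D
    refine ⟨D * (((k : ℝ≥0∞) + 1) *
      (volume : Measure (EuclideanSpace ℝ (Fin k))).toSphere Set.univ), ?_⟩
    rw [toSphere_succ hk]
    conv_lhs => rw [ht]
    rw [Measure.prod_smul_right, Measure.map_smul, smul_smul, smul_smul, mul_assoc]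
  have h1 : c * halfDisc k Set.univ = 1 := by
    have := hP'.measure_univ
    rw [hc, Measure.smul_apply, Measure.map_apply (measurable_latLift k) MeasurableSet.univ,
      Set.preimage_univ, ← Set.univ_prod_univ, Measure.prod_prod, hP.measure_univ, mul_one,
      smul_eq_mul] at this
    exact this
  have hc' : c = (halfDisc k Set.univ)⁻¹ := ENNReal.eq_inv_of_mul_eq_one_left h1
  refine ⟨⟨?_⟩, ?_⟩
  · rw [latMeasure, Measure.smul_apply, smul_eq_mul, ← hc', h1]
  · rw [hc, hc', latMeasure, Measure.prod_smul_left, Measure.map_smul]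

/-! ### Edge and triangle probabilities on the sphere -/

lemma sphereEdgeProb_nonneg (r : ℕ) (τ : ℝ) : 0 ≤ sphereEdgeProb r τ := measureReal_nonneg

lemma sphereTriangleProb_nonneg (r : ℕ) (τ : ℝ) : 0 ≤ sphereTriangleProb r τ := measureReal_nonneg

lemma measurableSet_cap {r : ℕ} (τ : ℝ) (x : Metric.sphere (0 : EuclideanSpace ℝ (Fin r)) 1) :
    MeasurableSet {z : Metric.sphere (0 : EuclideanSpace ℝ (Fin r)) 1 | τ ≤ inner ℝ z.1 x.1} :=
  measurableSet_inner τ measurable_id measurable_const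

lemma sphereEdgeProb_le_one {r : ℕ} (hr : 1 ≤ r) (τ : ℝ) : sphereEdgeProb r τ ≤ 1 := by
  have := isProbabilityMeasure_sphereUniform hr
  exact measureReal_le_one

lemma sphereEdgeProb_antitone {r : ℕ} (hr : 1 ≤ r) : Antitone (sphereEdgeProb r) := by
  have := isProbabilityMeasure_sphereUniform hr
  exact fun τ τ' h => measureReal_mono fun z (hz : τ' ≤ _) => h.trans hz

lemma sphereTriangleProb_antitone {r : ℕ} (hr : 1 ≤ r) : Antitone (sphereTriangleProb r) := by
  have := isProbabilityMeasure_sphereUniform hr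
  exact fun τ τ' h => measureReal_mono fun z hz =>
    ⟨h.trans hz.1, h.trans hz.2.1, h.trans hz.2.2⟩

lemma nonempty_sphere {r : ℕ} (hr : 1 ≤ r) :
    Nonempty (Metric.sphere (0 : EuclideanSpace ℝ (Fin r)) 1) := by
  have : Nonempty (Fin r) := ⟨⟨0, hr⟩⟩
  have : Nontrivial (EuclideanSpace ℝ (Fin r)) := inferInstance
  exact (NormedSpace.sphere_nonempty.2 zero_le_one).to_subtype

lemma inner_le_one {r : ℕ} (x y : Metric.sphere (0 : EuclideanSpace ℝ (Fin r)) 1) :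
    inner ℝ x.1 y.1 ≤ 1 := by
  simpa using real_inner_le_norm x.1 y.1

lemma half_le_sphereEdgeProb {r : ℕ} (hr : 1 ≤ r) {τ : ℝ} (hτ : τ ≤ 0) :
    1 / 2 ≤ sphereEdgeProb r τ := by
  refine le_trans ?_ (sphereEdgeProb_antitone hr hτ)
  have hP := isProbabilityMeasure_sphereUniform hr
  obtain ⟨x⟩ := nonempty_sphere hr
  have h1 := sphereUniform_cap hr 0 x
  have h2 := sphereUniform_cap hr 0 (-x)
  have hle : (1 : ℝ≥0∞) ≤ ENNReal.ofReal (sphereEdgeProb r 0 + sphereEdgeProb r 0) := by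
    rw [ENNReal.ofReal_add (sphereEdgeProb_nonneg _ _) (sphereEdgeProb_nonneg _ _)]
    nth_rewrite 1 [← h1]
    rw [← h2, ← hP.measure_univ]
    refine le_trans (measure_mono fun z _ => ?_) (measure_union_le _ _)
    simp only [Set.mem_union, Set.mem_ofPred_eq]
    rcases le_total 0 (inner ℝ z.1 x.1) with h | h
    · exact Or.inl h
    · exact Or.inr (by simpa using h)
  rw [← ENNReal.ofReal_one, ENNReal.ofReal_le_ofReal_iff (by
    linarith [sphereEdgeProb_nonneg r 0])] at hle
  linarith

/-- In dimension one, adjacency is transitive up to the value of the threshold. -/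
lemma sq_le_sphereTriangleProb_one {τ : ℝ} (hτ : τ ≤ 1) :
    sphereEdgeProb 1 τ ^ 2 ≤ sphereTriangleProb 1 τ := by
  have hP := isProbabilityMeasure_sphereUniform le_rfl
  obtain ⟨x⟩ := nonempty_sphere le_rfl
  have hin (y z : Metric.sphere (0 : EuclideanSpace ℝ (Fin 1)) 1) :
      inner ℝ y.1 z.1 = y.1 0 * z.1 0 := by simp [PiLp.inner_apply, mul_comm]
  have hsq (y : Metric.sphere (0 : EuclideanSpace ℝ (Fin 1)) 1) : y.1 0 = 1 ∨ y.1 0 = -1 := by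
    have h := hin y y
    rw [real_inner_self_eq_norm_sq, norm_eq_of_mem_sphere, one_pow] at h
    exact mul_self_eq_one_iff.1 h.symm
  rw [← ENNReal.ofReal_le_ofReal_iff (sphereTriangleProb_nonneg _ _),
    ← sphereUniform_triangle le_rfl τ x, sq,
    ENNReal.ofReal_mul (sphereEdgeProb_nonneg _ _), ← sphereUniform_cap le_rfl τ x,
    ← Measure.prod_prod]
  refine measure_mono fun z hz => ?_
  obtain ⟨h1, h2⟩ := hz
  simp only [Set.mem_ofPred_eq, hin] at h1 h2 ⊢
  rcases hsq x with hx | hx <;> rcases hsq z.1 with ha | ha <;> rcases hsq z.2 with hb | hb <;>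
    rw [hx] at h1 h2 ⊢ <;> rw [ha] at h1 ⊢ <;> rw [hb] at h2 ⊢ <;>
    refine ⟨?_, ?_, ?_⟩ <;> linarith

/-- The first coordinate vector. -/
noncomputable def pole (k : ℕ) : Metric.sphere (0 : EuclideanSpace ℝ (Fin (k + 1))) 1 :=
  ⟨consVec 1 0, by
    have h := norm_consVec_sq (k := k) 1 0
    rw [mem_sphere_zero_iff_norm]
    simp only [one_pow, norm_zero, ne_eq, OfNat.ofNat_ne_zero, not_false_eq_true, zero_pow,
      add_zero] at h
    nlinarith [norm_nonneg (consVec (k := k) 1 0)]⟩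

lemma inner_latLift_pole {k : ℕ} (z : ℝ × Set.Ioi (0 : ℝ))
    (w : Metric.sphere (0 : EuclideanSpace ℝ (Fin k)) 1) :
    inner ℝ (latLift z w).1 (pole k).1 = lat z := by
  rw [latLift, pole, inner_consVec]
  simp

lemma inner_latLift {k : ℕ} (z z' : ℝ × Set.Ioi (0 : ℝ))
    (w w' : Metric.sphere (0 : EuclideanSpace ℝ (Fin k)) 1) :
    inner ℝ (latLift z w).1 (latLift z' w').1 =
      lat z * lat z' + colat z * colat z' * inner ℝ w.1 w'.1 := by
  rw [latLift, latLift, inner_consVec, real_inner_smul_left, real_inner_smul_right, mul_assoc]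

/-- The law of the latitude. -/
lemma latMeasure_lat_ge {k : ℕ} (hk : 1 ≤ k) (τ : ℝ) :
    latMeasure k {z | τ ≤ lat z} = ENNReal.ofReal (sphereEdgeProb (k + 1) τ) := by
  have hP := isProbabilityMeasure_sphereUniform hk
  rw [← sphereUniform_cap (by omega) τ (pole k), (sphereUniform_succ hk).2,
    Measure.map_apply (measurable_latLift k) (measurableSet_cap τ _)]
  simp only [Set.preimage_ofPred_eq, inner_latLift_pole]
  rw [show {a : (ℝ × Set.Ioi (0 : ℝ)) × Metric.sphere (0 : EuclideanSpace ℝ (Fin k)) 1 |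
    τ ≤ lat a.1} = {z | τ ≤ lat z} ×ˢ Set.univ by ext; simp, Measure.prod_prod, hP.measure_univ,
    mul_one]

/-- Projecting the sphere to a hyperplane shows that caps shrink as the dimension grows. -/
lemma sphereEdgeProb_succ_le {k : ℕ} (hk : 1 ≤ k) {τ : ℝ} (hτ : 0 ≤ τ) :
    sphereEdgeProb (k + 1) τ ≤ sphereEdgeProb k τ := by
  have hP := isProbabilityMeasure_sphereUniform hk
  have hL := (sphereUniform_succ hk).1
  obtain ⟨w₀⟩ := nonempty_sphere hk
  have hmem : consVec 0 w₀.1 ∈ Metric.sphere (0 : EuclideanSpace ℝ (Fin (k + 1))) 1 := by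
    have h := norm_consVec_sq 0 w₀.1
    rw [norm_eq_of_mem_sphere] at h
    rw [mem_sphere_zero_iff_norm]
    nlinarith [norm_nonneg (consVec 0 w₀.1)]
  rw [← ENNReal.ofReal_le_ofReal_iff (sphereEdgeProb_nonneg _ _),
    ← sphereUniform_cap hk τ w₀, ← sphereUniform_cap (by omega) τ ⟨_, hmem⟩,
    (sphereUniform_succ hk).2, Measure.map_apply (measurable_latLift k)
      (measurableSet_cap τ _)]
  rw [← one_mul (sphereUniform k _), ← hL.measure_univ, ← Measure.prod_prod]
  refine measure_mono ?_
  rintro ⟨z, w⟩ h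
  refine ⟨trivial, ?_⟩
  simp only [Set.mem_preimage, Set.mem_ofPred_eq, latLift, inner_consVec, mul_zero, zero_add,
    real_inner_smul_left] at h ⊢
  have hc := colat_pos z
  have hc1 : colat z ≤ 1 := by nlinarith [lat_sq_add_colat_sq z, sq_nonneg (lat z)]
  have hi : 0 ≤ inner ℝ w.1 w₀.1 := by
    by_contra! hneg
    nlinarith
  nlinarith

/-- If two points have latitude at least that of a cap of height `τ`, and their meridians have
inner product at least `τ / (1 + τ)`, then their inner product is at least `τ`.  The worst case
is that of both points on the boundary of the cap. -/
lemma le_lat_mul_lat_add {τ s t c c' q : ℝ} (h0 : 0 ≤ τ) (h1 : τ < 1) (hs : τ ≤ s) (ht : τ ≤ t)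
    (hc : 0 < c) (hc' : 0 < c') (hsc : s ^ 2 + c ^ 2 = 1) (htc : t ^ 2 + c' ^ 2 = 1)
    (hq : τ / (1 + τ) ≤ q) : τ ≤ s * t + c * c' * q := by
  have hs1 : s ≤ 1 := by nlinarith
  have ht1 : t ≤ 1 := by nlinarith
  have hτ' : 0 < 1 - τ := by linarith
  -- The arc `√(1 - s ^ 2)` lies above its chord over `[τ, 1]`.
  have hchord {s c : ℝ} (hs : τ ≤ s) (hs1 : s ≤ 1) (hsc : s ^ 2 + c ^ 2 = 1) :
      (1 - s) ^ 2 * (1 - τ ^ 2) ≤ (c * (1 - τ)) ^ 2 := by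
    have e : (c * (1 - τ)) ^ 2 - (1 - s) ^ 2 * (1 - τ ^ 2) =
        (1 - s) * (1 - τ) * (2 * (s - τ)) := by
      have : c ^ 2 = 1 - s ^ 2 := by linarith
      rw [mul_pow, this]; ring
    have : 0 ≤ (1 - s) * (1 - τ) * (2 * (s - τ)) := by
      have := sub_nonneg.2 hs1
      have := sub_nonneg.2 hs
      positivity
    linarith
  have hprod : (1 - s) * (1 - t) * (1 - τ ^ 2) ≤ (c * (1 - τ)) * (c' * (1 - τ)) := by
    refine abs_le_of_sq_le_sq' ?_ (by positivity) |>.2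
    have h2 : 0 ≤ 1 - τ ^ 2 := by nlinarith
    calc ((1 - s) * (1 - t) * (1 - τ ^ 2)) ^ 2 =
        ((1 - s) ^ 2 * (1 - τ ^ 2)) * ((1 - t) ^ 2 * (1 - τ ^ 2)) := by ring
      _ ≤ (c * (1 - τ)) ^ 2 * (c' * (1 - τ)) ^ 2 :=
        mul_le_mul (hchord hs hs1 hsc) (hchord ht ht1 htc) (by positivity) (by positivity)
      _ = _ := by ring
  have hcc : (1 - s) * (1 - t) * (1 + τ) ≤ c * c' * (1 - τ) := by
    have : (1 - τ) * ((1 - s) * (1 - t) * (1 + τ)) ≤ (1 - τ) * (c * c' * (1 - τ)) := by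
      linarith [hprod]
    exact le_of_mul_le_mul_left this hτ'
  have hq' : τ ≤ q * (1 + τ) := by rwa [div_le_iff₀ (by linarith)] at hq
  have hmul : (1 - s) * (1 - t) * τ ≤ c * c' * q * (1 - τ) := by
    have hq0 : 0 ≤ q := le_trans (by positivity) hq
    have h3 := mul_le_mul_of_nonneg_right hcc hq0
    have h4 : 0 ≤ (1 - s) * (1 - t) := mul_nonneg (by linarith) (by linarith)
    nlinarith [mul_le_mul_of_nonneg_left hq' h4]
  have hfin : 0 ≤ (1 - τ) * (s * t + c * c' * q - τ) := by
    have h5 : 0 ≤ (s - τ) * (t - τ) := mul_nonneg (by linarith) (by linarith)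
    nlinarith
  have := nonneg_of_mul_nonneg_right hfin hτ'
  linarith

/-- Two points of a cap of height `τ` are adjacent as soon as their meridians have inner product
at least `τ / (1 + τ)`. -/
lemma sphereTriangleProb_ge {k : ℕ} (hk : 1 ≤ k) {τ : ℝ} (h0 : 0 ≤ τ) (h1 : τ < 1) :
    sphereEdgeProb (k + 1) τ ^ 2 * sphereEdgeProb k (τ / (1 + τ)) ≤
      sphereTriangleProb (k + 1) τ := by
  have hP := isProbabilityMeasure_sphereUniform hk
  have hP' := isProbabilityMeasure_sphereUniform (r := k + 1) (by omega)
  have hL := (sphereUniform_succ hk).1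
  have hE := sphereEdgeProb_nonneg (k + 1) τ
  have hT : MeasurableSet {z : Metric.sphere (0 : EuclideanSpace ℝ (Fin (k + 1))) 1 ×
      Metric.sphere (0 : EuclideanSpace ℝ (Fin (k + 1))) 1 | τ ≤ inner ℝ (pole k).1 z.1.1 ∧
      τ ≤ inner ℝ (pole k).1 z.2.1 ∧ τ ≤ inner ℝ z.1.1 z.2.1} :=
    (measurableSet_inner τ measurable_const measurable_fst).inter
      ((measurableSet_inner τ measurable_const measurable_snd).inter
        (measurableSet_inner τ measurable_fst measurable_snd))
  have hmap : (sphereUniform (k + 1)).prod (sphereUniform (k + 1)) =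
      Measure.map (Prod.map (fun x : (ℝ × Set.Ioi (0 : ℝ)) × _ => latLift x.1 x.2)
        (fun x : (ℝ × Set.Ioi (0 : ℝ)) × _ => latLift x.1 x.2))
        (((latMeasure k).prod (sphereUniform k)).prod ((latMeasure k).prod (sphereUniform k))) := by
    rw [(sphereUniform_succ hk).2, Measure.map_prod_map _ _ (measurable_latLift k)
      (measurable_latLift k)]
  have hm := (measurable_latLift k).prodMap (measurable_latLift k)
  rw [← ENNReal.ofReal_le_ofReal_iff (sphereTriangleProb_nonneg _ _),
    ← sphereUniform_triangle (by omega) τ (pole k), hmap, Measure.map_apply hm hT,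
    Measure.prod_apply (hm hT)]
  have hA : MeasurableSet ({z | τ ≤ lat z} ×ˢ Set.univ : Set ((ℝ × Set.Ioi (0 : ℝ)) ×
      Metric.sphere (0 : EuclideanSpace ℝ (Fin k)) 1)) :=
    (measurableSet_le measurable_const measurable_lat).prod MeasurableSet.univ
  calc ENNReal.ofReal (sphereEdgeProb (k + 1) τ ^ 2 * sphereEdgeProb k (τ / (1 + τ)))
      = ∫⁻ x, (({z | τ ≤ lat z} ×ˢ Set.univ : Set ((ℝ × Set.Ioi (0 : ℝ)) ×
          Metric.sphere (0 : EuclideanSpace ℝ (Fin k)) 1))).indicator (fun _ =>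
          ENNReal.ofReal (sphereEdgeProb (k + 1) τ) *
            ENNReal.ofReal (sphereEdgeProb k (τ / (1 + τ)))) x
          ∂((latMeasure k).prod (sphereUniform k)) := by
        rw [lintegral_indicator_const hA, Measure.prod_prod, latMeasure_lat_ge hk,
          hP.measure_univ, mul_one, sq, mul_assoc, ENNReal.ofReal_mul hE, ENNReal.ofReal_mul hE,
          mul_comm (ENNReal.ofReal _)]
    _ ≤ _ := by
        refine lintegral_mono fun ⟨z, w⟩ => ?_
        refine Set.indicator_apply_le' (fun hz => ?_) fun _ => zero_le
        rw [← latMeasure_lat_ge hk, ← sphereUniform_cap hk _ w, ← Measure.prod_prod]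
        refine measure_mono ?_
        rintro ⟨z', w'⟩ ⟨hz', hw'⟩
        simp only [Set.mem_prod, Set.mem_univ, and_true, Set.mem_ofPred_eq] at hz hz' hw'
        simp only [Set.mem_preimage, Set.mem_ofPred_eq, Prod.map_apply]
        rw [real_inner_comm, inner_latLift_pole, real_inner_comm, inner_latLift_pole,
          inner_latLift]
        refine ⟨hz, hz', le_lat_mul_lat_add h0 h1 hz hz' (colat_pos z) (colat_pos z')
          (lat_sq_add_colat_sq z) (lat_sq_add_colat_sq z') ?_⟩
        rwa [real_inner_comm]

/-- For nonpositive thresholds, compare with the threshold `0`. -/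
lemma eighth_le_sphereTriangleProb {r : ℕ} (hr : 2 ≤ r) {τ : ℝ} (hτ : τ ≤ 0) :
    1 / 8 ≤ sphereTriangleProb r τ := by
  obtain ⟨k, rfl⟩ : ∃ k, r = k + 1 := ⟨r - 1, by omega⟩
  refine le_trans ?_ (sphereTriangleProb_antitone (by omega) hτ)
  refine le_trans ?_ (sphereTriangleProb_ge (by omega) le_rfl zero_lt_one)
  have h1 := half_le_sphereEdgeProb (r := k + 1) (by omega) le_rfl
  have h2 := half_le_sphereEdgeProb (r := k) (by omega) (τ := 0 / (1 + 0)) (by simp)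
  calc (1 / 8 : ℝ) = (1 / 2) ^ 2 * (1 / 2) := by norm_num
    _ ≤ _ := by gcongr

/-! ### The distribution of the latitude -/

/-- The weight `(1 + q ^ 2) ^ (-r / 2)`, up to a constant the density of the tangent of the
latitude of a uniform point of the sphere of `ℝ^r`. -/
noncomputable def tanWeight (r : ℕ) (q : ℝ) : ℝ := (√(1 + q ^ 2))⁻¹ ^ r

lemma tanWeight_pos (r : ℕ) (q : ℝ) : 0 < tanWeight r q := by
  unfold tanWeight; positivity

lemma continuous_tanWeight (r : ℕ) : Continuous (tanWeight r) := by
  unfold tanWeight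
  have h (q : ℝ) : √(1 + q ^ 2) ≠ 0 := by positivity
  fun_prop (disch := exact h _)

lemma lintegral_volumeIoiPow_succ (n : ℕ) {f : Set.Ioi (0 : ℝ) → ℝ≥0∞} (hf : Measurable f) :
    ∫⁻ R, ENNReal.ofReal R.1 * f R ∂(Measure.volumeIoiPow n) =
      ∫⁻ R, f R ∂(Measure.volumeIoiPow (n + 1)) := by
  have hw (m : ℕ) : Measurable fun R : Set.Ioi (0 : ℝ) => ENNReal.ofReal (R.1 ^ m) := by fun_prop
  have hRf : Measurable fun R : Set.Ioi (0 : ℝ) => ENNReal.ofReal R.1 * f R := by fun_prop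
  rw [Measure.volumeIoiPow, Measure.volumeIoiPow, lintegral_withDensity_eq_lintegral_mul _
    (hw n) hRf, lintegral_withDensity_eq_lintegral_mul _ (hw (n + 1)) hf]
  refine lintegral_congr fun R => ?_
  simp only [Pi.mul_apply]
  rw [pow_succ, ENNReal.ofReal_mul (pow_nonneg (le_of_lt R.2) _), mul_assoc]

/-- Under `halfDisc k`, the tangent `a / R` of the latitude has density
`tanWeight (k + 1) / (k + 1)`: substitute `a = R q` and integrate over `R`. -/
lemma halfDisc_ratio {k : ℕ} (hk : 1 ≤ k) {T : Set ℝ} (hT : MeasurableSet T) :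
    halfDisc k {z | z.1 / z.2.1 ∈ T} =
      ∫⁻ q in T, ENNReal.ofReal (tanWeight (k + 1) q / (k + 1)) := by
  have hm : MeasurableSet {z : ℝ × Set.Ioi (0 : ℝ) | z.1 / z.2.1 ∈ T} :=
    measurableSet_preimage (f := fun z : ℝ × Set.Ioi (0 : ℝ) => z.1 / z.2.1) (by fun_prop) hT
  set X : Set (ℝ × Set.Ioi (0 : ℝ)) :=
    {z | z.1 ∈ T ∧ z.2.1 ^ 2 * (1 + z.1 ^ 2) < 1} with hX
  have hXg : Measurable fun z : ℝ × Set.Ioi (0 : ℝ) => z.2.1 ^ 2 * (1 + z.1 ^ 2) := by fun_prop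
  have hXm : MeasurableSet X :=
    (measurable_fst hT).inter (measurableSet_lt hXg measurable_const)
  have hX2 : ((volume : Measure ℝ).prod (Measure.volumeIoiPow k)) X =
      ∫⁻ q in T, ENNReal.ofReal (tanWeight (k + 1) q / (k + 1)) := by
    rw [Measure.prod_apply hXm, ← lintegral_indicator hT]
    refine lintegral_congr fun q => ?_
    by_cases hq : q ∈ T
    · rw [Set.indicator_of_mem hq]
      have hpos : 0 < (√(1 + q ^ 2))⁻¹ := by positivity
      have : Prod.mk q ⁻¹' X = Set.Iio ⟨(√(1 + q ^ 2))⁻¹, hpos⟩ := by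
        ext R
        have hR : 0 < R.1 := R.2
        simp only [hX, Set.mem_preimage, Set.mem_ofPred_eq, hq, true_and, Set.mem_Iio]
        rw [← Subtype.coe_lt_coe, lt_inv_comm₀ hR (by positivity),
          Real.sqrt_lt' (by positivity), inv_pow, lt_inv_comm₀ (by positivity) (by positivity),
          lt_inv_comm₀ (by positivity) (by positivity), ← one_div, lt_div_iff₀ (by positivity)]
        rw [mul_comm]
      rw [this, Measure.volumeIoiPow_apply_Iio, tanWeight]
    · rw [Set.indicator_of_notMem hq]
      refine (congrArg _ (Set.eq_empty_iff_forall_notMem.2 fun R => ?_)).trans measure_empty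
      simp [hX, hq]
  rw [← hX2, Measure.prod_apply_symm hXm]
  obtain ⟨n, rfl⟩ : ∃ n, k = n + 1 := ⟨k - 1, by omega⟩
  rw [← lintegral_volumeIoiPow_succ n (measurable_measure_prodMk_right hXm), halfDisc,
    Measure.restrict_apply hm, Measure.prod_apply_symm (hm.inter measurableSet_halfDisc),
    Nat.add_sub_cancel]
  refine lintegral_congr fun R => ?_
  have hR : 0 < R.1 := R.2
  have h := Real.volume_preimage_mul_left hR.ne' ((fun x => (x, R)) ⁻¹'
    ({z : ℝ × Set.Ioi (0 : ℝ) | z.1 / z.2.1 ∈ T} ∩ {z | z.1 ^ 2 + z.2.1 ^ 2 < 1}))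
  have hset : (fun x => R.1 * x) ⁻¹' ((fun x => (x, R)) ⁻¹'
      ({z : ℝ × Set.Ioi (0 : ℝ) | z.1 / z.2.1 ∈ T} ∩ {z | z.1 ^ 2 + z.2.1 ^ 2 < 1})) =
      (fun x => (x, R)) ⁻¹' X := by
    ext q
    simp only [hX, Set.mem_preimage, Set.mem_inter_iff, Set.mem_ofPred_eq]
    rw [mul_div_cancel_left₀ _ hR.ne', mul_pow, mul_add, mul_one, add_comm (R.1 ^ 2)]
  rw [hset] at h
  rw [h, ← mul_assoc, ← ENNReal.ofReal_mul hR.le, abs_of_pos (inv_pos.2 hR),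
    mul_inv_cancel₀ hR.ne', ENNReal.ofReal_one, one_mul]

lemma tanWeight_le {r : ℕ} (hr : 2 ≤ r) (q : ℝ) : tanWeight r q ≤ (1 + q ^ 2)⁻¹ := by
  have h1 : (√(1 + q ^ 2))⁻¹ ≤ 1 := by
    rw [inv_le_one₀ (by positivity), Real.one_le_sqrt]
    nlinarith [sq_nonneg q]
  calc tanWeight r q ≤ (√(1 + q ^ 2))⁻¹ ^ 2 := pow_le_pow_of_le_one (by positivity) h1 hr
    _ = (1 + q ^ 2)⁻¹ := by rw [inv_pow, Real.sq_sqrt (by positivity)]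

lemma integrable_tanWeight {r : ℕ} (hr : 2 ≤ r) : Integrable (tanWeight r) := by
  refine integrable_inv_one_add_sq.mono' (continuous_tanWeight r).aestronglyMeasurable ?_
  refine Eventually.of_forall fun q => ?_
  rw [Real.norm_eq_abs, abs_of_pos (tanWeight_pos r q)]
  exact tanWeight_le hr q

lemma integral_tanWeight_pos {r : ℕ} (hr : 2 ≤ r) : 0 < ∫ q, tanWeight r q := by
  rw [integral_pos_iff_support_of_nonneg (fun q => (tanWeight_pos r q).le)
    (integrable_tanWeight hr)]
  have : Function.support (tanWeight r) = Set.univ := by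
    ext q; simp [(tanWeight_pos r q).ne']
  simp [this]

/-- A point lies in a cap of height `τ` when the tangent of its latitude is at
least `τ / √(1 - τ ^ 2)`. -/
lemma sphereEdgeProb_eq {r : ℕ} (hr : 2 ≤ r) {τ : ℝ} (h0 : 0 ≤ τ) (h1 : τ < 1) :
    sphereEdgeProb r τ = (∫ q in Set.Ioi (τ / √(1 - τ ^ 2)), tanWeight r q) /
      ∫ q, tanWeight r q := by
  obtain ⟨k, rfl⟩ : ∃ k, r = k + 1 := ⟨r - 1, by omega⟩
  have hk : 1 ≤ k := by omega
  have hreal {T : Set ℝ} (hT : MeasurableSet T) : (halfDisc k).real {z | z.1 / z.2.1 ∈ T} =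
      (∫ q in T, tanWeight (k + 1) q) / (k + 1) := by
    rw [measureReal_def, halfDisc_ratio hk hT, ← integral_div, integral_eq_lintegral_of_nonneg_ae]
    · exact Eventually.of_forall fun q => by
        have := tanWeight_pos (k + 1) q
        positivity
    · exact ((continuous_tanWeight _).div_const _).aestronglyMeasurable
  have hset : {z : ℝ × Set.Ioi (0 : ℝ) | τ ≤ lat z} =
      {z | z.1 / z.2.1 ∈ Set.Ici (τ / √(1 - τ ^ 2))} := by
    ext ⟨a, R⟩
    have hR : 0 < R.1 := R.2
    have hpos := lat_norm_pos (a, R)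
    have hτ : 0 < 1 - τ ^ 2 := by nlinarith
    simp only [Set.mem_ofPred_eq, Set.mem_Ici, lat] at hpos ⊢
    rw [le_div_iff₀ (Real.sqrt_pos.2 hpos), div_le_div_iff₀ (Real.sqrt_pos.2 hτ) hR]
    have e1 : (τ * √(a ^ 2 + R.1 ^ 2)) ^ 2 = τ ^ 2 * (a ^ 2 + R.1 ^ 2) := by
      rw [mul_pow, Real.sq_sqrt hpos.le]
    have e2 : (a * √(1 - τ ^ 2)) ^ 2 = a ^ 2 * (1 - τ ^ 2) := by
      rw [mul_pow, Real.sq_sqrt hτ.le]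
    have p1 := Real.sqrt_nonneg (a ^ 2 + R.1 ^ 2)
    have p2 := Real.sqrt_pos.2 hτ
    constructor
    · intro h
      have ha : 0 ≤ a := le_trans (by positivity) h
      have h2 := pow_le_pow_left₀ (by positivity) h 2
      refine (abs_le_of_sq_le_sq' ?_ (by positivity)).2
      rw [e2]
      nlinarith
    · intro h
      have ha : 0 ≤ a := by
        have : 0 ≤ a * √(1 - τ ^ 2) := le_trans (by positivity) h
        exact nonneg_of_mul_nonneg_left this p2
      have h2 := pow_le_pow_left₀ (by positivity) h 2
      rw [e2] at h2
      refine (abs_le_of_sq_le_sq' ?_ ha).2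
      rw [e1]
      nlinarith
  have h := latMeasure_lat_ge hk τ
  have huniv := hreal MeasurableSet.univ
  simp only [Set.mem_univ, Set.ofPred_true, setIntegral_univ] at huniv
  rw [← ENNReal.toReal_ofReal (sphereEdgeProb_nonneg (k + 1) τ), ← h, latMeasure,
    Measure.smul_apply, smul_eq_mul, ENNReal.toReal_mul, ENNReal.toReal_inv, ← measureReal_def,
    ← measureReal_def, hset, hreal measurableSet_Ici, huniv, integral_Ici_eq_integral_Ioi]
  field_simp

/-! ### Bounds for the measure of spherical caps -/

lemma sphereEdgeProb_eq_zero {r : ℕ} (hr : 2 ≤ r) {τ : ℝ} (hτ : 1 ≤ τ) :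
    sphereEdgeProb r τ = 0 := by
  obtain ⟨k, rfl⟩ : ∃ k, r = k + 1 := ⟨r - 1, by omega⟩
  have h := latMeasure_lat_ge (k := k) (by omega) τ
  have hset : {z : ℝ × Set.Ioi (0 : ℝ) | τ ≤ lat z} = ∅ := by
    rw [Set.eq_empty_iff_forall_notMem]
    intro z (hz : τ ≤ lat z)
    nlinarith [colat_pos z, lat_sq_add_colat_sq z]
  rw [hset, measure_empty, eq_comm, ENNReal.ofReal_eq_zero] at h
  exact le_antisymm h (sphereEdgeProb_nonneg _ _)

/-- Scaling `q = (κ' / κ) u` compares the tails of the density of the tangent of the latitude;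
the ratio of the integrands is smallest at `u = κ`. -/
lemma integral_tanWeight_tail_ge {r : ℕ} (hr : 2 ≤ r) {κ κ' : ℝ} (h0 : 0 < κ') (h : κ' ≤ κ) :
    κ' / κ * (√((1 + κ ^ 2) / (1 + κ' ^ 2))) ^ r * ∫ q in Set.Ioi κ, tanWeight r q ≤
      ∫ q in Set.Ioi κ', tanWeight r q := by
  have hκ : 0 < κ := h0.trans_le h
  have hα : 0 < κ' / κ := div_pos h0 hκ
  have hs := integral_comp_mul_left_Ioi (tanWeight r) κ hα
  rw [div_mul_cancel₀ _ hκ.ne', smul_eq_mul, eq_inv_mul_iff_mul_eq₀ hα.ne'] at hs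
  rw [← hs, mul_assoc, ← integral_const_mul]
  refine mul_le_mul_of_nonneg_left ?_ hα.le
  refine setIntegral_mono_on ((integrable_tanWeight hr).const_mul _).integrableOn
    ((integrable_tanWeight hr).comp_mul_left' hα.ne').integrableOn measurableSet_Ioi fun u hu => ?_
  rw [tanWeight, tanWeight, ← mul_pow]
  refine pow_le_pow_left₀ (by positivity) ?_ r
  rw [← div_eq_mul_inv, ← Real.sqrt_div (by positivity), ← Real.sqrt_inv]
  refine Real.sqrt_le_sqrt ?_
  rw [inv_eq_one_div, div_div, div_le_div_iff₀ (by positivity) (by positivity)]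
  have hu' : κ ≤ u := le_of_lt hu
  have e : (κ' / κ * u) ^ 2 = κ' ^ 2 * u ^ 2 / κ ^ 2 := by field_simp
  rw [e, ← sub_nonneg]
  have e2 : 1 * ((1 + κ' ^ 2) * (1 + u ^ 2)) - (1 + κ ^ 2) * (1 + κ' ^ 2 * u ^ 2 / κ ^ 2) =
      (u ^ 2 - κ ^ 2) * (κ ^ 2 - κ' ^ 2) / κ ^ 2 := by
    field_simp
    ring
  rw [e2]
  have h1 : 0 ≤ u ^ 2 - κ ^ 2 := by nlinarith
  have h2 : 0 ≤ κ ^ 2 - κ' ^ 2 := by nlinarith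
  positivity

/-- A cap of smaller height is larger by a factor that is exponential in the dimension. -/
lemma sphereEdgeProb_ge_of_le {r : ℕ} (hr : 2 ≤ r) {τ τ' : ℝ} (h0 : 0 < τ') (h : τ' ≤ τ)
    (h1 : τ < 1) : τ' / τ * (√((1 - τ' ^ 2) / (1 - τ ^ 2))) ^ (r - 1) * sphereEdgeProb r τ ≤
      sphereEdgeProb r τ' := by
  have hτ : 0 < τ := h0.trans_le h
  have ht : 0 < 1 - τ ^ 2 := by nlinarith
  have ht' : 0 < 1 - τ' ^ 2 := by nlinarith
  have hsq {t : ℝ} (ht : 0 < 1 - t ^ 2) : 1 + (t / √(1 - t ^ 2)) ^ 2 = (1 - t ^ 2)⁻¹ := by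
    rw [div_pow, Real.sq_sqrt ht.le]
    field_simp
    ring
  have hκ : τ' / √(1 - τ' ^ 2) ≤ τ / √(1 - τ ^ 2) := by
    have : 1 - τ ^ 2 ≤ 1 - τ' ^ 2 := by nlinarith
    gcongr
  have hI := integral_tanWeight_pos hr
  have key := integral_tanWeight_tail_ge hr (div_pos h0 (Real.sqrt_pos.2 ht')) hκ
  rw [hsq ht, hsq ht'] at key
  have hb : (1 - τ ^ 2)⁻¹ / (1 - τ' ^ 2)⁻¹ = (1 - τ' ^ 2) / (1 - τ ^ 2) := by
    field_simp
  rw [hb] at key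
  have hfac : τ' / √(1 - τ' ^ 2) / (τ / √(1 - τ ^ 2)) * (√((1 - τ' ^ 2) / (1 - τ ^ 2))) ^ r =
      τ' / τ * (√((1 - τ' ^ 2) / (1 - τ ^ 2))) ^ (r - 1) := by
    obtain ⟨m, rfl⟩ : ∃ m, r = m + 1 := ⟨r - 1, by omega⟩
    rw [pow_succ _ m, Nat.add_sub_cancel, Real.sqrt_div ht'.le]
    have := (Real.sqrt_pos.2 ht).ne'
    have := (Real.sqrt_pos.2 ht').ne'
    field_simp
  rw [hfac] at key
  rw [sphereEdgeProb_eq hr hτ.le h1, sphereEdgeProb_eq hr h0.le (h.trans_lt h1), mul_div_assoc']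
  gcongr

lemma integral_tanWeight_le {r : ℕ} (hr : 2 ≤ r) : ∫ q, tanWeight r q ≤ 5 / √r := by
  have hr0 : (2 : ℝ) ≤ r := by exact_mod_cast hr
  have hs : 0 < √((r : ℝ) / 2) := Real.sqrt_pos.2 (by positivity)
  have hle (q : ℝ) : tanWeight r q ≤ (1 + (√((r : ℝ) / 2) * q) ^ 2)⁻¹ := by
    rw [tanWeight, inv_pow]
    refine inv_anti₀ (by positivity) ?_
    have h := one_add_mul_self_le_rpow_one_add (s := q ^ 2) (by nlinarith [sq_nonneg q])
      (p := (r : ℝ) / 2) (by linarith)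
    rw [Real.rpow_div_two_eq_sqrt _ (by positivity), Real.rpow_natCast] at h
    rwa [mul_pow, Real.sq_sqrt (by positivity)]
  have hint : Integrable fun q : ℝ => (1 + (√((r : ℝ) / 2) * q) ^ 2)⁻¹ :=
    integrable_inv_one_add_sq.comp_mul_left' hs.ne'
  refine (integral_mono (integrable_tanWeight hr) hint hle).trans ?_
  rw [Measure.integral_comp_mul_left (fun x : ℝ => (1 + x ^ 2)⁻¹), integral_univ_inv_one_add_sq,
    abs_of_pos (inv_pos.2 hs), smul_eq_mul, Real.sqrt_div (by positivity), inv_div,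
    div_mul_eq_mul_div]
  have h2 : √2 ≤ 1.42 := by rw [Real.sqrt_le_left (by norm_num)]; norm_num
  have hpi := Real.pi_lt_d2
  have hpi0 := Real.pi_pos
  gcongr
  nlinarith

lemma integral_tanWeight_tail_lower {r : ℕ} (hr : 2 ≤ r) {κ κ₀ : ℝ} (h : κ ≤ κ₀) (h0 : 0 < κ₀) :
    κ₀ * tanWeight r (2 * κ₀) ≤ ∫ q in Set.Ioi κ, tanWeight r q := by
  have hsub : Set.Ioc κ₀ (2 * κ₀) ⊆ Set.Ioi κ := fun q hq => h.trans_lt hq.1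
  calc κ₀ * tanWeight r (2 * κ₀) = ∫ _ in Set.Ioc κ₀ (2 * κ₀), tanWeight r (2 * κ₀) := by
        rw [setIntegral_const, Real.volume_real_Ioc_of_le (by linarith), smul_eq_mul]
        ring
    _ ≤ ∫ q in Set.Ioc κ₀ (2 * κ₀), tanWeight r q := by
        refine setIntegral_mono_on (integrableOn_const measure_Ioc_lt_top.ne)
          (integrable_tanWeight hr).integrableOn measurableSet_Ioc fun q hq => ?_
        unfold tanWeight
        have : 0 < q := h0.trans hq.1
        have := hq.2
        gcongr
    _ ≤ _ := setIntegral_mono_set (integrable_tanWeight hr).integrableOn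
        (Eventually.of_forall fun q => (tanWeight_pos r q).le) hsub.eventuallyLE

lemma log_tanWeight (r : ℕ) (q : ℝ) :
    Real.log (tanWeight r q) = -(r / 2 * Real.log (1 + q ^ 2)) := by
  rw [tanWeight, Real.log_pow, Real.log_inv, Real.log_sqrt (by positivity)]
  ring

/-- A lower bound for the measure of a cap, from the part of the tail of `tanWeight` between
`κ` and `2 κ`, where `κ` is the tangent of the latitude of the boundary. -/
lemma sphereEdgeProb_pos_and_log_le {r : ℕ} (hr : 2 ≤ r) {τ : ℝ} (h0 : 0 ≤ τ) (h1 : τ < 1) :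
    0 < sphereEdgeProb r τ ∧ Real.log (1 / sphereEdgeProb r τ) ≤
      4 + r / 2 * Real.log ((1 + 3 * τ ^ 2) / (1 - τ ^ 2)) := by
  have ht : 0 < 1 - τ ^ 2 := by nlinarith
  have hr0 : (0 : ℝ) < r := by exact_mod_cast (by omega : 0 < r)
  have hsr : 0 < √(r : ℝ) := Real.sqrt_pos.2 hr0
  have hI := integral_tanWeight_pos hr
  set κ := τ / √(1 - τ ^ 2) with hκ
  have hκ0 : 0 ≤ κ := by positivity
  have hκ2 : 1 + (2 * κ) ^ 2 = (1 + 3 * τ ^ 2) / (1 - τ ^ 2) := by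
    rw [hκ, mul_pow, div_pow, Real.sq_sqrt ht.le]
    field_simp
    ring
  -- At heights below `1 / √r` the bound at height `1 / √r` is used.
  set κ₀ := max κ (1 / √(r : ℝ)) with hκ₀
  have hκ₀1 : 1 / √(r : ℝ) ≤ κ₀ := le_max_right _ _
  have hκ₀0 : 0 < κ₀ := lt_of_lt_of_le (by positivity) hκ₀1
  have hw := tanWeight_pos r (2 * κ₀)
  have hlow : tanWeight r (2 * κ₀) / 5 ≤ sphereEdgeProb r τ := by
    rw [sphereEdgeProb_eq hr h0 h1, div_le_div_iff₀ (by norm_num) hI]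
    have hH := integral_tanWeight_tail_lower hr (le_max_left κ (1 / √(r : ℝ))) hκ₀0
    calc tanWeight r (2 * κ₀) * ∫ q, tanWeight r q
        ≤ tanWeight r (2 * κ₀) * (5 / √r) := by gcongr; exact integral_tanWeight_le hr
      _ = 1 / √r * tanWeight r (2 * κ₀) * 5 := by ring
      _ ≤ κ₀ * tanWeight r (2 * κ₀) * 5 := by gcongr
      _ ≤ _ := by gcongr
  have hpos : 0 < sphereEdgeProb r τ := lt_of_lt_of_le (by positivity) hlow
  refine ⟨hpos, ?_⟩
  have h5 : Real.log 5 ≤ 2 := by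
    rw [Real.log_le_iff_le_exp (by norm_num)]
    have := Real.exp_one_gt_d9
    rw [show (2 : ℝ) = 1 + 1 by norm_num, Real.exp_add]
    nlinarith
  have hlog := Real.log_le_log (by positivity) hlow
  rw [Real.log_div hw.ne' (by norm_num), log_tanWeight] at hlog
  rw [one_div, Real.log_inv, ← hκ2]
  have hmax : (r : ℝ) / 2 * Real.log (1 + (2 * κ₀) ^ 2) ≤
      2 + r / 2 * Real.log (1 + (2 * κ) ^ 2) := by
    rcases le_total (1 / √(r : ℝ)) κ with h | h
    · rw [hκ₀, max_eq_left h]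
      linarith
    · rw [hκ₀, max_eq_right h]
      have h2 : Real.log (1 + (2 * (1 / √(r : ℝ))) ^ 2) ≤ 4 / r := by
        refine (Real.log_le_sub_one_of_pos (by positivity)).trans (le_of_eq ?_)
        rw [mul_pow, div_pow, Real.sq_sqrt hr0.le]
        ring
      have h3 : 0 ≤ (r : ℝ) / 2 * Real.log (1 + (2 * κ) ^ 2) := by
        have := Real.log_nonneg (by nlinarith [sq_nonneg (2 * κ)] : 1 ≤ 1 + (2 * κ) ^ 2)
        positivity
      calc (r : ℝ) / 2 * Real.log (1 + (2 * (1 / √(r : ℝ))) ^ 2) ≤ r / 2 * (4 / r) := by gcongr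
        _ = 2 := by field_simp; norm_num
        _ ≤ _ := by linarith
  linarith

/-- The gain per dimension when the height `τ` is lowered to `τ / (1 + τ)`, compared with the loss
per dimension in `sphereEdgeProb_pos_and_log_le`. -/
lemma log_gain_ge {τ : ℝ} (h0 : 0 < τ) (h1 : τ < 1) :
    τ / 16 * Real.log ((1 + 3 * τ ^ 2) / (1 - τ ^ 2)) ≤
      Real.log ((1 - (τ / (1 + τ)) ^ 2) / (1 - τ ^ 2)) := by
  have ht : 0 < 1 - τ ^ 2 := by nlinarith
  set b := (1 - (τ / (1 + τ)) ^ 2) / (1 - τ ^ 2) with hb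
  have hbe : b = (1 + 2 * τ) / ((1 - τ ^ 2) * (1 + τ) ^ 2) := by
    rw [hb]; field_simp; ring
  have hd : 0 < (1 - τ ^ 2) * (1 + τ) ^ 2 := by positivity
  have hb1 : 1 + τ ^ 3 ≤ b := by
    rw [hbe, le_div_iff₀ hd]
    have : 1 + 2 * τ - (1 + τ ^ 3) * ((1 - τ ^ 2) * (1 + τ) ^ 2) =
        τ ^ 3 * (1 - τ + 2 * τ ^ 3 + τ ^ 4) := by ring
    have h2 : 0 ≤ 1 - τ + 2 * τ ^ 3 + τ ^ 4 := by
      have := sub_pos.2 h1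
      positivity
    have := mul_nonneg (pow_pos h0 3).le h2
    linarith
  have hb0 : 0 < b := lt_of_lt_of_le (by positivity) hb1
  have hτ3 : 0 < τ ^ 3 := by positivity
  have hlb : 0 ≤ Real.log b := Real.log_nonneg (by linarith)
  have hx0 : 0 < (1 + 3 * τ ^ 2) / (1 - τ ^ 2) := by positivity
  have hx1 : 1 ≤ (1 + 3 * τ ^ 2) / (1 - τ ^ 2) := by
    rw [le_div_iff₀ ht]; nlinarith
  rcases le_total τ (1 / 2) with h | h
  · have e1 : Real.log ((1 + 3 * τ ^ 2) / (1 - τ ^ 2)) ≤ 16 / 3 * τ ^ 2 := by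
      refine (Real.log_le_sub_one_of_pos hx0).trans ?_
      rw [sub_le_iff_le_add, div_le_iff₀ ht]
      nlinarith [mul_nonneg (sq_nonneg τ) (by nlinarith : (0 : ℝ) ≤ 1 / 4 - τ ^ 2)]
    have e2 : τ ^ 3 / 2 ≤ Real.log b := by
      refine le_trans ?_ (Real.log_le_log (by positivity) hb1)
      refine le_trans ?_ (Real.one_sub_inv_le_log_of_pos (by positivity))
      have : 1 - (1 + τ ^ 3)⁻¹ = τ ^ 3 / (1 + τ ^ 3) := by field_simp; ring
      rw [this]
      gcongr
      nlinarith [pow_le_one₀ h0.le h1.le (n := 3)]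
    calc _ ≤ τ / 16 * (16 / 3 * τ ^ 2) := by gcongr
      _ = τ ^ 3 / 3 := by ring
      _ ≤ τ ^ 3 / 2 := by linarith
      _ ≤ _ := e2
  · have e1 : (1 + 3 * τ ^ 2) / (1 - τ ^ 2) ≤ 16 / 3 * b := by
      rw [hbe, mul_div_assoc', div_le_div_iff₀ ht hd]
      have : (1 + 3 * τ ^ 2) * (1 + τ) ^ 2 ≤ 16 / 3 * (1 + 2 * τ) := by
        nlinarith [mul_nonneg h0.le (sub_nonneg.2 h1.le), pow_le_one₀ h0.le h1.le (n := 2),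
          pow_le_one₀ h0.le h1.le (n := 3), pow_le_one₀ h0.le h1.le (n := 4)]
      nlinarith
    have hb2 : 9 / 8 ≤ b := by
      have : (1 / 2 : ℝ) ^ 3 ≤ τ ^ 3 := by gcongr
      linarith
    have e2 : (1 + 3 * τ ^ 2) / (1 - τ ^ 2) ≤ b ^ 16 := by
      refine e1.trans ?_
      have : (9 / 8 : ℝ) ^ 15 ≤ b ^ 15 := by gcongr
      have h3 : (16 / 3 : ℝ) ≤ b ^ 15 := le_trans (by norm_num) this
      calc 16 / 3 * b ≤ b ^ 15 * b := by gcongr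
        _ = b ^ 16 := by ring
    have e3 := Real.log_le_log hx0 e2
    rw [Real.log_pow] at e3
    push_cast at e3
    have e4 := Real.log_nonneg hx1
    nlinarith

/-- The triangle probability exceeds that of a random graph with independent edges by a factor
that grows with `τ ln (1 / p)`. -/
lemma sphereTriangleProb_ge_exp {r : ℕ} (hr : 2 ≤ r) {τ : ℝ} (h0 : 0 < τ) (h1 : τ < 1) :
    1 / 2 * Real.exp (τ / 32 * (Real.log (1 / sphereEdgeProb r τ) - 4)) * sphereEdgeProb r τ ^ 3 ≤
      sphereTriangleProb r τ := by
  obtain ⟨k, rfl⟩ : ∃ k, r = k + 1 := ⟨r - 1, by omega⟩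
  have ht : 0 < 1 - τ ^ 2 := by nlinarith
  have h0' : 0 < τ / (1 + τ) := by positivity
  have hle : τ / (1 + τ) ≤ τ := div_le_self h0.le (by linarith)
  have hhalf : 1 / 2 ≤ τ / (1 + τ) / τ := by
    rw [div_div, mul_comm, ← div_div, div_self h0.ne']
    gcongr
    linarith
  have hp := sphereEdgeProb_nonneg (k + 1) τ
  have hgain := sphereEdgeProb_ge_of_le hr h0' hle h1
  have hlog := (sphereEdgeProb_pos_and_log_le hr h0.le h1).2
  have hb := log_gain_ge h0 h1
  set b := (1 - (τ / (1 + τ)) ^ 2) / (1 - τ ^ 2) with hbdef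
  set X := Real.log ((1 + 3 * τ ^ 2) / (1 - τ ^ 2))
  have hX : 0 ≤ X := Real.log_nonneg (by rw [le_div_iff₀ ht]; nlinarith)
  have hb0 : 0 < b := div_pos (by nlinarith) ht
  have hlb : 0 ≤ Real.log b := le_trans (by positivity) hb
  have hexp : Real.exp (τ / 32 * (Real.log (1 / sphereEdgeProb (k + 1) τ) - 4)) ≤
      (√b) ^ (k + 1 - 1) := by
    rw [← Real.le_log_iff_exp_le (by positivity), Real.log_pow, Real.log_sqrt hb0.le,
      Nat.add_sub_cancel]
    have hk : (k : ℝ) + 1 ≤ 2 * k := by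
      have : (1 : ℝ) ≤ k := by exact_mod_cast (by omega : 1 ≤ k)
      linarith
    push_cast at hlog
    calc τ / 32 * (Real.log (1 / sphereEdgeProb (k + 1) τ) - 4)
        ≤ τ / 32 * (((k : ℝ) + 1) / 2 * X) := by gcongr; linarith
      _ = ((k : ℝ) + 1) / 4 * (τ / 16 * X) := by ring
      _ ≤ (2 * k) / 4 * Real.log b := by gcongr
      _ = k * (Real.log b / 2) := by ring
  calc 1 / 2 * Real.exp (τ / 32 * (Real.log (1 / sphereEdgeProb (k + 1) τ) - 4)) *
        sphereEdgeProb (k + 1) τ ^ 3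
      ≤ τ / (1 + τ) / τ * (√b) ^ (k + 1 - 1) * sphereEdgeProb (k + 1) τ ^ 3 := by gcongr
    _ = sphereEdgeProb (k + 1) τ ^ 2 *
        (τ / (1 + τ) / τ * (√b) ^ (k + 1 - 1) * sphereEdgeProb (k + 1) τ) := by ring
    _ ≤ sphereEdgeProb (k + 1) τ ^ 2 * sphereEdgeProb k (τ / (1 + τ)) := by
        gcongr
        exact hgain.trans (sphereEdgeProb_succ_le (by omega) h0'.le)
    _ ≤ _ := sphereTriangleProb_ge (by omega) h0.le h1

/-- The triangle probability is at least that of a random graph with independent edges. -/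
lemma cube_le_sphereTriangleProb {r : ℕ} (hr : 2 ≤ r) {τ : ℝ} (h0 : 0 ≤ τ) (h1 : τ < 1) :
    sphereEdgeProb r τ ^ 3 ≤ sphereTriangleProb r τ := by
  obtain ⟨k, rfl⟩ : ∃ k, r = k + 1 := ⟨r - 1, by omega⟩
  have hp := sphereEdgeProb_nonneg (k + 1) τ
  calc sphereEdgeProb (k + 1) τ ^ 3 = sphereEdgeProb (k + 1) τ ^ 2 * sphereEdgeProb (k + 1) τ := by
        ring
    _ ≤ sphereEdgeProb (k + 1) τ ^ 2 * sphereEdgeProb k (τ / (1 + τ)) := by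
        gcongr
        refine (sphereEdgeProb_antitone (by omega) ?_).trans
          (sphereEdgeProb_succ_le (by omega) (by positivity))
        exact div_le_self h0 (by linarith)
    _ ≤ _ := sphereTriangleProb_ge (by omega) h0 h1

/-- In dimension at most `K (ln (1 / p)) ^ 2`, triangles are more likely by any given factor than
in a random graph with independent edges, when `p` is small. -/
lemma mul_cube_le_sphereTriangleProb {r : ℕ} (hr : 2 ≤ r) {τ : ℝ} (h0 : 0 < τ) (h1 : τ < 1)
    {K M : ℝ} (hK : 0 < K) (hM : 0 < M)
    (hrK : r ≤ K * Real.log (1 / sphereEdgeProb r τ) ^ 2)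
    (hL8 : 8 ≤ Real.log (1 / sphereEdgeProb r τ))
    (hLM : 256 * M ≤ Real.log (1 / sphereEdgeProb r τ))
    (hLK : 6 * K * (128 * M) ^ 2 ≤ Real.log (1 / sphereEdgeProb r τ)) :
    M * sphereEdgeProb r τ ^ 3 ≤ sphereTriangleProb r τ := by
  refine le_trans ?_ (sphereTriangleProb_ge_exp hr h0 h1)
  have hlog := (sphereEdgeProb_pos_and_log_le hr h0.le h1).2
  have hp := sphereEdgeProb_nonneg r τ
  set L := Real.log (1 / sphereEdgeProb r τ) with hL
  have ht : 0 < 1 - τ ^ 2 := by nlinarith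
  have hτL : 128 * M ≤ τ * L := by
    rcases le_total τ (1 / 2) with h | h
    · have e1 : Real.log ((1 + 3 * τ ^ 2) / (1 - τ ^ 2)) ≤ 6 * τ ^ 2 := by
        refine (Real.log_le_sub_one_of_pos (by positivity)).trans ?_
        rw [sub_le_iff_le_add, div_le_iff₀ ht]
        nlinarith [mul_nonneg (sq_nonneg τ) (by nlinarith : (0 : ℝ) ≤ 1 / 4 - τ ^ 2)]
      have e2 : L / 2 ≤ 3 * K * (τ * L) ^ 2 := by
        calc L / 2 ≤ L - 4 := by linarith
          _ ≤ r / 2 * Real.log ((1 + 3 * τ ^ 2) / (1 - τ ^ 2)) := by linarith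
          _ ≤ r / 2 * (6 * τ ^ 2) := by gcongr
          _ ≤ (K * L ^ 2) / 2 * (6 * τ ^ 2) := by gcongr
          _ = _ := by ring
      have e3 : (128 * M) ^ 2 ≤ (τ * L) ^ 2 := by
        have : (6 * K) * (128 * M) ^ 2 ≤ (6 * K) * (τ * L) ^ 2 := by linarith
        exact le_of_mul_le_mul_left this (by positivity)
      exact (abs_le_of_sq_le_sq' e3 (by positivity)).2
    · nlinarith
  gcongr
  have := Real.add_one_le_exp (τ / 32 * (L - 4))
  have : τ * L / 2 ≤ τ * (L - 4) := by nlinarith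
  nlinarith

/-! ### Uniform bounds on the class of random geometric graphs -/

/-- On the class, the expected number of triangles is large compared to the expected number of
edges per vertex: `n ^ 2 μ(Q) / p_Q` tends to infinity uniformly.  This is where the upper bound
on the dimension enters. -/
lemma eventually_mul_edge_le_triangle (C : ℝ) {M : ℝ} (hM : 1 ≤ M) :
    ∀ᶠ n : ℕ in atTop, ∀ Q ∈ geomClass C n, ∃ p m : ℝ, EdgeTriangleLaw Q p m ∧
      edgeProb n Q = p ∧ 1 / (n : ℝ) ≤ p ∧ M * p ≤ n ^ 2 * m := by
  have hlogn : Tendsto (fun n : ℕ => Real.log n) atTop atTop :=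
    Real.tendsto_log_atTop.comp tendsto_natCast_atTop_atTop
  filter_upwards [hlogn.eventually_ge_atTop
    (Real.log M + max 8 (max (256 * M) (6 * M ^ 2 * (128 * M) ^ 2))),
    tendsto_natCast_atTop_atTop.eventually_ge_atTop (8 * M), eventually_ge_atTop 2]
    with n hlog hn8 hn2 Q hQ
  obtain ⟨_, r, p, hgeom, hnp, _, hr⟩ := hQ
  have hE := hgeom.edgeProb_eq hn2
  obtain ⟨hr1, τ, hpτ, hQ⟩ := hgeom
  change sphereEdgeProb r τ = p at hpτ
  subst hpτ
  refine ⟨_, sphereTriangleProb r τ, edgeTriangleLaw_of_map hr1 τ hQ, hE, hnp, ?_⟩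
  have hn : (2 : ℝ) ≤ n := by exact_mod_cast hn2
  have hn0 : (0 : ℝ) < n := by linarith
  have hp0 : 0 < sphereEdgeProb r τ := lt_of_lt_of_le (by positivity) hnp
  have hp1 := sphereEdgeProb_le_one hr1 τ
  set p := sphereEdgeProb r τ with hp
  have hω : 1 ≤ n * p := by
    rw [div_le_iff₀ hn0] at hnp
    linarith
  rcases hr1.eq_or_lt with rfl | hr2
  · have hτ : τ ≤ 1 := by
      by_contra! h
      have : p = 0 := by
        rw [hp, sphereEdgeProb, show {z : Metric.sphere (0 : EuclideanSpace ℝ (Fin 1)) 1 ×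
          Metric.sphere (0 : EuclideanSpace ℝ (Fin 1)) 1 | τ ≤ inner ℝ z.1.1 z.2.1} = ∅ from
          Set.eq_empty_iff_forall_notMem.2 fun z hz => (h.trans_le hz).not_ge (inner_le_one _ _)]
        simp
      exact hp0.ne' this
    have := sq_le_sphereTriangleProb_one hτ
    calc M * p ≤ n * p := by gcongr; linarith
      _ ≤ (n * p) * (n * p) := by nlinarith
      _ = n ^ 2 * p ^ 2 := by ring
      _ ≤ _ := by gcongr
  rcases le_or_gt τ 0 with hτ0 | hτ0
  · have := eighth_le_sphereTriangleProb hr2 hτ0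
    calc M * p ≤ M := by nlinarith
      _ ≤ n ^ 2 * (1 / 8) := by nlinarith
      _ ≤ _ := by gcongr
  have hτ1 : τ < 1 := by
    by_contra! h
    exact hp0.ne' (sphereEdgeProb_eq_zero hr2 h)
  rcases le_or_gt M ((n * p) ^ 2) with hbig | hsmall
  · calc M * p ≤ (n * p) ^ 2 * p := by gcongr
      _ = n ^ 2 * p ^ 3 := by ring
      _ ≤ _ := by gcongr; exact cube_le_sphereTriangleProb hr2 hτ0.le hτ1
  · -- Here `p` is of order `1 / n`, so `ln (1 / p)` is close to `ln n` and `r` is of order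
    -- `ln (1 / p) ^ 2`.
    have hM0 : 0 < M := by linarith
    have hlogn0 : 0 < Real.log n := Real.log_pos (by linarith)
    set L := Real.log (1 / p) with hL
    have hL0 : 0 ≤ L := Real.log_nonneg (by rw [le_div_iff₀ hp0]; linarith)
    have hLn : L ≤ Real.log n := by
      refine Real.log_le_log (by positivity) ?_
      rwa [div_le_iff₀ hp0]
    have hLlow : Real.log n - Real.log M ≤ L := by
      rw [← Real.log_div hn0.ne' hM0.ne']
      refine Real.log_le_log (by positivity) ?_
      rw [div_le_div_iff₀ hM0 hp0]
      nlinarith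
    have hLmax : max 8 (max (256 * M) (6 * M ^ 2 * (128 * M) ^ 2)) ≤ L := by linarith
    have hrK : (r : ℝ) ≤ M ^ 2 * L ^ 2 := by
      refine hr.trans ?_
      rw [div_le_iff₀ hlogn0]
      calc (n * p) ^ 4 * L ^ 3 = ((n * p) ^ 2) ^ 2 * (L ^ 2 * L) := by ring
        _ ≤ M ^ 2 * (L ^ 2 * Real.log n) := by gcongr
        _ = _ := by ring
    have h3 := mul_cube_le_sphereTriangleProb hr2 hτ0 hτ1 (by positivity) hM0 hrK
      ((le_max_left _ _).trans hLmax) ((le_max_left _ _).trans ((le_max_right _ _).trans hLmax))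
      ((le_max_right _ _).trans ((le_max_right _ _).trans hLmax))
    calc M * p ≤ (n * p) ^ 2 * (M * p) :=
           le_mul_of_one_le_left (by positivity) (one_le_pow₀ hω)
      _ = n ^ 2 * (M * p ^ 3) := by ring
      _ ≤ _ := by gcongr

lemma eventually_sigmaTri_pos (C : ℝ) :
    ∀ᶠ n : ℕ in atTop, ∀ Q ∈ geomClass C n, 0 < sigmaTri n Q := by
  filter_upwards [eventually_mul_edge_le_triangle C le_rfl, eventually_ge_atTop 3] with n h hn Q hQ
  obtain ⟨p, m, hlaw, hE, hp, hm⟩ := h Q hQ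
  have hn0 : (3 : ℝ) ≤ n := by exact_mod_cast hn
  have hp0 : 0 < p := lt_of_lt_of_le (by positivity) hp
  have hm0 : 0 < m := pos_of_mul_pos_right (lt_of_lt_of_le (by positivity) hm) (by positivity)
  have hC : (0 : ℝ) < n.choose 3 := by exact_mod_cast Nat.choose_pos hn
  have hlog : 0 < Real.log n := Real.log_pos (by linarith)
  rw [sigmaTri, hE, hlaw.muTri_eq hn]
  positivity

lemma eventually_measure_fTri_le (C : ℝ) {ε : ℝ≥0∞} (hε : 0 < ε) :
    ∀ᶠ n : ℕ in atTop, ∀ Q ∈ geomClass C n, (Q : Measure (SimpleGraph (Fin n)))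
      {G | sigmaTri n Q < dist (fTri n G) (muTri n Q)} ≤ ε := by
  have hlim : Tendsto (fun n : ℕ => ENNReal.ofReal (1 / Real.log n)) atTop (𝓝 0) := by
    rw [← ENNReal.ofReal_zero]
    refine ENNReal.tendsto_ofReal ?_
    simp only [one_div]
    exact (Real.tendsto_log_atTop.comp tendsto_natCast_atTop_atTop).inv_tendsto_atTop
  filter_upwards [eventually_mul_edge_le_triangle C le_rfl, eventually_sigmaTri_pos C,
    eventually_ge_atTop 3, ENNReal.tendsto_nhds_zero.1 hlim ε hε] with n h hσ hn hle Q hQ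
  obtain ⟨p, m, hlaw, hE, hp, hm⟩ := h Q hQ
  have hn0 : (3 : ℝ) ≤ n := by exact_mod_cast hn
  have hp0 : 0 < p := lt_of_lt_of_le (by positivity) hp
  have hm0 : 0 < m := pos_of_mul_pos_right (lt_of_lt_of_le (by positivity) hm) (by positivity)
  have hC : (0 : ℝ) < n.choose 3 := by exact_mod_cast Nat.choose_pos hn
  have hlog : 0 < Real.log n := Real.log_pos (by linarith)
  refine le_trans (measure_mono ?_) ((hlaw.measure_fTri_le hn (hσ Q hQ)).trans (le_trans
    (ENNReal.ofReal_le_ofReal (le_of_eq ?_)) hle))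
  · intro G hG
    rw [Set.mem_ofPred_eq, Real.dist_eq, hlaw.muTri_eq hn] at hG
    exact hG.le
  · rw [sigmaTri, hE, hlaw.muTri_eq hn, Real.sq_sqrt (by positivity)]
    field_simp

lemma cube_le_choose_three {n : ℕ} (hn : 3 ≤ n) : (n : ℝ) ^ 3 / 162 ≤ n.choose 3 := by
  have h := Nat.pow_le_choose (α := ℝ) 3 n
  have e : ((n + 1 - 3 : ℕ) : ℝ) = n - 2 := by
    rw [show n + 1 - 3 = n - 2 by omega, Nat.cast_sub (by omega)]
    norm_num
  rw [e] at h
  have hn0 : (3 : ℝ) ≤ n := by exact_mod_cast hn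
  have h3 : ((n : ℝ) / 3) ^ 3 ≤ (n - 2) ^ 3 := by gcongr; linarith
  simp only [Nat.factorial] at h
  push_cast at h
  linarith [show ((n : ℝ) / 3) ^ 3 = n ^ 3 / 27 by ring]

lemma sq_le_choose_two {n : ℕ} (hn : 2 ≤ n) : (n : ℝ) ^ 2 / 8 ≤ n.choose 2 := by
  have h := Nat.pow_le_choose (α := ℝ) 2 n
  have e : ((n + 1 - 2 : ℕ) : ℝ) = n - 1 := by
    rw [show n + 1 - 2 = n - 1 by omega, Nat.cast_sub (by omega)]
    norm_num
  rw [e] at h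
  have hn0 : (2 : ℝ) ≤ n := by exact_mod_cast hn
  have h3 : ((n : ℝ) / 2) ^ 2 ≤ (n - 1) ^ 2 := by gcongr; linarith
  simp only [Nat.factorial] at h
  push_cast at h
  linarith [show ((n : ℝ) / 2) ^ 2 = n ^ 2 / 4 by ring]

/-- Relative errors of at most `η` in the edge density and the triangle density give a relative
error of at most `η` in the deviation. -/
lemma abs_sigmaHatTri_sub_le {n : ℕ} {Q : GraphDist n} {p m η : ℝ} (hE : edgeProb n Q = p)
    (hμ : muTri n Q = m) (hp : 0 ≤ p) (hm : 0 ≤ m) (h0 : 0 ≤ η) (h1 : η ≤ 1)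
    {G : SimpleGraph (Fin n)} (hf : |fTri n G - m| ≤ η * m) (he : |edgeDensity n G - p| ≤ η * p) :
    |sigmaHatTri n G - sigmaTri n Q| ≤ η * sigmaTri n Q := by
  rw [abs_le] at hf he
  have hη : 0 ≤ 1 - η := by linarith
  have hl : 0 ≤ Real.log n / (n.choose 3 : ℝ) := by
    have := Real.log_natCast_nonneg n
    positivity
  have hup {x y : ℝ} (hx : 0 ≤ x) : x * √y = √(x ^ 2 * y) := by
    rw [Real.sqrt_mul (sq_nonneg x), Real.sqrt_sq hx]
  have hnn : (0 : ℝ) ≤ n := Nat.cast_nonneg n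
  have hs1 : sigmaHatTri n G ≤ (1 + η) * sigmaTri n Q := by
    rw [sigmaHatTri, sigmaTri, hE, hμ, hup (by linarith)]
    refine Real.sqrt_le_sqrt ?_
    have h1 : 3 * n * edgeDensity n G + 1 ≤ (1 + η) * (3 * n * p + 1) := by
      have := mul_le_mul_of_nonneg_left (by linarith : edgeDensity n G ≤ (1 + η) * p)
        (by positivity : (0 : ℝ) ≤ 3 * n)
      nlinarith
    have h2 : fTri n G ≤ (1 + η) * m := by linarith
    have h3 : 0 ≤ fTri n G := by nlinarith
    calc _ = (3 * n * edgeDensity n G + 1) * fTri n G * (Real.log n / (n.choose 3 : ℝ)) := by ring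
      _ ≤ ((1 + η) * (3 * n * p + 1)) * ((1 + η) * m) * (Real.log n / (n.choose 3 : ℝ)) := by
        gcongr
      _ = _ := by ring
  have hs2 : (1 - η) * sigmaTri n Q ≤ sigmaHatTri n G := by
    rw [sigmaHatTri, sigmaTri, hE, hμ, hup hη]
    refine Real.sqrt_le_sqrt ?_
    have h1 : (1 - η) * (3 * n * p + 1) ≤ 3 * n * edgeDensity n G + 1 := by
      have := mul_le_mul_of_nonneg_left (by linarith : (1 - η) * p ≤ edgeDensity n G)
        (by positivity : (0 : ℝ) ≤ 3 * n)
      nlinarith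
    have h2 : (1 - η) * m ≤ fTri n G := by linarith
    have h4 : 0 ≤ 3 * n * edgeDensity n G + 1 := le_trans (by positivity) h1
    calc _ = ((1 - η) * (3 * n * p + 1)) * ((1 - η) * m) * (Real.log n / (n.choose 3 : ℝ)) := by
          ring
      _ ≤ (3 * n * edgeDensity n G + 1) * fTri n G * (Real.log n / (n.choose 3 : ℝ)) := by
        gcongr
      _ = _ := by ring
  rw [abs_le]
  constructor <;> linarith

lemma eventually_measure_sigmaHatTri_le (C : ℝ) {δ : ℝ} (hδ : 0 < δ) {ε : ℝ≥0∞} (hε : 0 < ε) :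
    ∀ᶠ n : ℕ in atTop, ∀ Q ∈ geomClass C n, (Q : Measure (SimpleGraph (Fin n)))
      {G | δ * sigmaTri n Q < |sigmaHatTri n G - sigmaTri n Q|} ≤ ε := by
  set η := min δ 1 with hη
  have hη0 : 0 < η := lt_min hδ one_pos
  have hinv {c : ℝ} : Tendsto (fun x : ℝ => ENNReal.ofReal (c / x)) atTop (𝓝 0) := by
    rw [← ENNReal.ofReal_zero]
    exact ENNReal.tendsto_ofReal (tendsto_const_nhds.div_atTop tendsto_id)
  have hε2 : 0 < ε / 2 := ENNReal.half_pos hε.ne'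
  obtain ⟨M, hM, hM1⟩ := ((ENNReal.tendsto_nhds_zero.1 (hinv (c := 648 / η ^ 2)) (ε / 2)
    hε2).and (eventually_ge_atTop 1)).exists
  filter_upwards [eventually_mul_edge_le_triangle C hM1, eventually_ge_atTop 3,
    ENNReal.tendsto_nhds_zero.1 ((hinv (c := 8 / η ^ 2)).comp tendsto_natCast_atTop_atTop)
      (ε / 2) hε2] with n h hn hle Q hQ
  obtain ⟨p, m, hlaw, hE, hp, hm⟩ := h Q hQ
  have hn0 : (3 : ℝ) ≤ n := by exact_mod_cast hn
  have hp0 : 0 < p := lt_of_lt_of_le (by positivity) hp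
  have hm0 : 0 < m := pos_of_mul_pos_right (lt_of_lt_of_le (by positivity) hm) (by positivity)
  have hC := cube_le_choose_three hn
  have hC2 := sq_le_choose_two (n := n) (by omega)
  have hC0 : (0 : ℝ) < n.choose 3 := by exact_mod_cast Nat.choose_pos hn
  have hC20 : (0 : ℝ) < n.choose 2 := by exact_mod_cast Nat.choose_pos (by omega : 2 ≤ n)
  have hnp : 1 ≤ n * p := by
    rw [div_le_iff₀ (by linarith)] at hp
    linarith
  have hσ : 0 ≤ sigmaTri n Q := Real.sqrt_nonneg _
  have hsub : {G | δ * sigmaTri n Q < |sigmaHatTri n G - sigmaTri n Q|} ⊆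
      {G | η * m ≤ |fTri n G - m|} ∪ {G | η * p ≤ |edgeDensity n G - p|} := by
    intro G hG
    by_contra hcon
    simp only [Set.mem_union, Set.mem_ofPred_eq, not_or, not_le] at hcon hG
    have := abs_sigmaHatTri_sub_le hE (hlaw.muTri_eq hn) hp0.le hm0.le hη0.le (min_le_right _ _)
      hcon.1.le hcon.2.le
    have : η * sigmaTri n Q ≤ δ * sigmaTri n Q := by gcongr; exact min_le_left _ _
    linarith
  calc _ ≤ _ := measure_mono hsub
    _ ≤ _ := measure_union_le _ _
    _ ≤ ε / 2 + ε / 2 := by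
      refine add_le_add ((hlaw.measure_fTri_le hn (by positivity)).trans (le_trans
        (ENNReal.ofReal_le_ofReal ?_) hM)) ((hlaw.measure_edgeDensity_le (by omega)
        (by positivity)).trans (le_trans (ENNReal.ofReal_le_ofReal ?_) hle))
      · rw [div_div, div_le_div_iff₀ (by positivity) (by positivity)]
        calc (3 * n * p + 1) * m * (η ^ 2 * M) ≤ (4 * (n * p)) * m * (η ^ 2 * M) := by
              gcongr; linarith
          _ = 4 * n * m * η ^ 2 * (M * p) := by ring
          _ ≤ 4 * n * m * η ^ 2 * (n ^ 2 * m) := by gcongr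
          _ = 648 * (n ^ 3 / 162 * (η * m) ^ 2) := by ring
          _ ≤ _ := by gcongr
      · rw [div_div, div_le_div_iff₀ (by positivity) (by positivity)]
        calc p * (η ^ 2 * n) ≤ (n * p) * (p * (η ^ 2 * n)) := by
              have : 0 < p * (η ^ 2 * n) := by positivity
              nlinarith
          _ = 8 * (n ^ 2 / 8 * (η * p) ^ 2) := by ring
          _ ≤ _ := by gcongr
    _ = ε := ENNReal.add_halves ε

/-! ### Consistency of the test -/

lemma testStat_le_one {f f' μ μ' σ σ' s s' : ℝ} (hf : |f - μ| ≤ σ) (hf' : |f' - μ'| ≤ σ')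
    (hs : |s - σ| ≤ 1 / 4 * σ) (hs' : |s' - σ'| ≤ 1 / 4 * σ') (hσ : 0 < σ) (hσ' : 0 < σ')
    (hμ : |μ - μ'| ≤ 0) : |f - f'| / (2 * s + 2 * s') ≤ 1 := by
  rw [abs_le] at *
  rw [div_le_one (by linarith), abs_le]
  constructor <;> linarith

lemma one_lt_testStat {f f' μ μ' σ σ' s s' : ℝ} (hf : |f - μ| ≤ σ) (hf' : |f' - μ'| ≤ σ')
    (hs : |s - σ| ≤ 1 / 4 * σ) (hs' : |s' - σ'| ≤ 1 / 4 * σ') (hσ : 0 < σ) (hσ' : 0 < σ')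
    (hμ : 3.5 * (σ + σ') < |μ - μ'|) : 1 < |f - f'| / (2 * s + 2 * s') := by
  rw [abs_le] at *
  rw [one_lt_div (by linarith), lt_abs]
  rcases lt_abs.1 hμ with h | h
  · left; linarith
  · right; linarith

/-- The union bound for independent graphs, with an exceptional set for each. -/
lemma prod_measure_le_add {α β : Type*} [MeasurableSpace α] [MeasurableSpace β] {P : Measure α}
    {P' : Measure β} [IsProbabilityMeasure P] [IsProbabilityMeasure P'] {A : Set (α × β)}
    {B : Set α} {B' : Set β} (h : ∀ x ∉ B, ∀ y ∉ B', (x, y) ∉ A) :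
    (P.prod P') A ≤ P B + P' B' := by
  have hsub : A ⊆ B ×ˢ Set.univ ∪ Set.univ ×ˢ B' := by
    rintro ⟨x, y⟩ hxy
    by_contra hcon
    simp only [Set.mem_union, Set.mem_prod, Set.mem_univ, and_true, true_and, not_or] at hcon
    exact h x hcon.1 y hcon.2 hxy
  calc _ ≤ _ := measure_mono hsub
    _ ≤ _ := measure_union_le _ _
    _ = _ := by simp [Measure.prod_prod]

/-- A graph is exceptional when its triangle density or its estimated deviation is off. -/
def exceptional (n : ℕ) (Q : GraphDist n) : Set (SimpleGraph (Fin n)) :=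
  {G | sigmaTri n Q < dist (fTri n G) (muTri n Q)} ∪
    {G | 1 / 4 * sigmaTri n Q < |sigmaHatTri n G - sigmaTri n Q|}

lemma uniformlyConsistent_geomClass (C : ℝ)
    {ρ : (n : ℕ) → GraphDist n → (n' : ℕ) → GraphDist n' → ℝ}
    (hρ : ∀ (n : ℕ) (Q : GraphDist n) (n' : ℕ) (Q' : GraphDist n'), Q ∈ geomClass C n →
      Q' ∈ geomClass C n' → 3.5 * (sigmaTri n Q + sigmaTri n' Q') ≤ ρ n Q n' Q') :
    UniformlyConsistent fTri (geomClass C) muTri sigmaHatTri (fun _ _ _ _ => 0) ρ := by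
  rw [UniformlyConsistent, ENNReal.tendsto_nhds_zero]
  intro ε hε
  have hε8 : 0 < ε / 8 := ENNReal.div_pos hε.ne' (by simp)
  have hall := ((eventually_measure_fTri_le C hε8).and
    ((eventually_measure_sigmaHatTri_le C (δ := 1 / 4) (by norm_num) hε8).and
      (eventually_sigmaTri_pos C)))
  filter_upwards [eventually_forall_ge_atTop.2 hall] with n hn
  have hexc (m : ℕ) (hm : n ≤ m) (Q : GraphDist m) (hQ : Q ∈ geomClass C m) :
      (Q : Measure (SimpleGraph (Fin m))) (exceptional m Q) ≤ ε / 8 + ε / 8 :=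
    (measure_union_le _ _).trans (add_le_add ((hn m hm).1 Q hQ) ((hn m hm).2.1 Q hQ))
  have hsum : (ε / 8 + ε / 8 + (ε / 8 + ε / 8)) + (ε / 8 + ε / 8 + (ε / 8 + ε / 8)) = ε := by
    calc _ = ε / 8 * 8 := by ring
      _ = ε := ENNReal.div_mul_cancel (by simp) (by simp)
  have hgood {m : ℕ} {Q : GraphDist m} {G : SimpleGraph (Fin m)} (hG : G ∉ exceptional m Q) :
      |fTri m G - muTri m Q| ≤ sigmaTri m Q ∧
        |sigmaHatTri m G - sigmaTri m Q| ≤ 1 / 4 * sigmaTri m Q := by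
    simpa only [exceptional, Set.mem_union, Set.mem_ofPred_eq, not_or, not_lt,
      Real.dist_eq] using hG
  refine iSup₂_le fun m hm => iSup₂_le fun Q hQ => ?_
  rw [← hsum]
  refine add_le_add (iSup₂_le fun m' hm' => iSup₂_le fun Q' hQ' => ?_)
    (iSup₂_le fun m' hm' => iSup₂_le fun Q' hQ' => ?_)
  · refine (prod_measure_le_add (B := exceptional m Q) (B' := exceptional m' Q')
      fun G hG G' hG' => ?_).trans (add_le_add (hexc m hm Q hQ) (hexc m' hm' Q' hQ'.1))
    have hμ := hQ'.2
    rw [Real.dist_eq] at hμ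
    rw [Set.mem_ofPred_eq, not_lt, testStat, Real.dist_eq]
    exact testStat_le_one (hgood hG).1 (hgood hG').1 (hgood hG).2 (hgood hG').2
      ((hn m hm).2.2 Q hQ) ((hn m' hm').2.2 Q' hQ'.1) hμ
  · refine (prod_measure_le_add (B := exceptional m Q) (B' := exceptional m' Q')
      fun G hG G' hG' => ?_).trans (add_le_add (hexc m hm Q hQ) (hexc m' hm' Q' hQ'.1))
    have hμ := (hρ m Q m' Q' hQ hQ'.1).trans_lt hQ'.2
    rw [Real.dist_eq] at hμ
    rw [Set.mem_ofPred_eq, not_le, testStat, Real.dist_eq]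
    exact one_lt_testStat (hgood hG).1 (hgood hG').1 (hgood hG).2 (hgood hG').2
      ((hn m hm).2.2 Q hQ) ((hn m' hm').2.2 Q' hQ'.1) hμ

end TwoSample

theorem corollary2 (C : ℝ) (hC : 0 < C) :
    TwoSample.Concentrates TwoSample.fTri (TwoSample.geomClass C) TwoSample.muTri
        TwoSample.sigmaTri ∧
      TwoSample.EstimatesDeviation (TwoSample.geomClass C) TwoSample.sigmaTri
        TwoSample.sigmaHatTri ∧
      ∀ ρ : (n : ℕ) → TwoSample.GraphDist n → (n' : ℕ) → TwoSample.GraphDist n' → ℝ,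
        (∀ (n : ℕ) (Q : TwoSample.GraphDist n) (n' : ℕ) (Q' : TwoSample.GraphDist n'),
          Q ∈ TwoSample.geomClass C n → Q' ∈ TwoSample.geomClass C n' →
            3.5 * (TwoSample.sigmaTri n Q + TwoSample.sigmaTri n' Q') ≤ ρ n Q n' Q') →
        TwoSample.UniformlyConsistent TwoSample.fTri (TwoSample.geomClass C) TwoSample.muTri
          TwoSample.sigmaHatTri (fun _ _ _ _ => 0) ρ := by
  refine ⟨ENNReal.tendsto_nhds_zero.2 fun ε hε => ?_, fun δ hδ =>
    ENNReal.tendsto_nhds_zero.2 fun ε hε => ?_, fun ρ hρ =>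
    TwoSample.uniformlyConsistent_geomClass C hρ⟩
  · filter_upwards [TwoSample.eventually_measure_fTri_le C hε] with n hn
    exact iSup₂_le hn
  · filter_upwards [TwoSample.eventually_measure_sigmaHatTri_le C hδ hε] with n hn
    exact iSup₂_le hn
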